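/- A $2$-NFA is a quintuple $\mathcal A=(V,E,F,s,\Sigma)$ with a finite set $V$ of states, a finite alphabet $\Sigma$ totally ordered by $\prec$, a set $E\subseteq V\times V\times\Sigma$ of labelled edges, a set $F\subseteq V$ of accepting states and a source $s\in V$, such that $s$ is the only state with in-degree zero, every state is reachable from $s$, and for all $u\in V$ and $a\in\Sigma$ there are at most two edges $(u,v,a)\in E$. A \emph{Wheeler order} of $\mathcal A$ is a strict total order $<$ on $V$ such that states with in-degree zero precede states with positive in-degree and, for any two edges $(u_1,v_1,a_1),(u_2,v_2,a_2)\in E$, (i) $a_1\prec a_2$ implies $v_1<v_2$, and (ii) $a_1=a_2$ and $u_1<u_2$ imply $v_1\le v_2$. The automaton $\mathcal A$ is a \emph{Wheeler graph} if it has a Wheeler order. Theorem. There is an algorithm which, given a $2$-NFA $\mathcal A=(V,E,F,s,\Sigma)$, in time $O(|E|^2)$ 1. decides whether $\mathcal A$ is a Wheeler graph, and 2. if it is, returns the list of the states of $\mathcal A$ in a Wheeler order. Precisely: there are a single word RAM program and a constant $C$ such that, for every $2$-NFA with $V=\{0,\dots,n-1\}$ and $\Sigma=\{0,\dots,k-1\}$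 (ordered as usual), given by $n$, $|E|$, $k$, $s$, an arbitrarily ordered list of its edges and the indicator vector of $F$, and for every word range $\{0,\dots,W-1\}$ with $W\ge(|E|+k+2)^C$ (that is, words of $O(\log(|E|+k))$ bits suffice), the program halts with the correct answers to 1 and 2 after at most $C\,(|E|^2+1)$ unit-cost operations. -/

import Mathlib

/-! ### Automata and Wheeler graphs -/

/-- A `d`-NFA with set of states `V` and alphabet `A`.  An edge `(u, v, a)` leads from `u` to `v`
and carries the label `a`. -/
structure DNFA (d : ℕ) (V A : Type) where
  /-- the labelled edges -/
  edges : Finset (V × V × A)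
  /-- the accepting states -/
  accept : Finset V
  /-- the start state, or source -/
  start : V
  /-- the source is the only state with in-degree zero -/
  no_in_edge_iff : ∀ v, (¬ ∃ u a, (u, v, a) ∈ edges) ↔ v = start
  /-- at most `d` equally labelled edges leave any state -/
  out_le : ∀ (u : V) (a : A), {e | e ∈ edges ∧ e.1 = u ∧ e.2.2 = a}.ncard ≤ d
  /-- every state is reachable from the source -/
  reachable : ∀ v, Relation.ReflTransGen (fun x y => ∃ a, (x, y, a) ∈ edges) start v

/-- The relation `lt` is a strict total order of the vertices satisfying the Wheeler properties
for the labelled edges `E`. -/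
structure IsWheelerOrder {V A : Type} [LinearOrder A] (E : Finset (V × V × A))
    (lt : V → V → Prop) : Prop where
  /-- `lt` is a strict total order -/
  total : IsStrictTotalOrder V lt
  /-- vertices with in-degree zero precede those with positive in-degree -/
  source_first : ∀ x y, (¬ ∃ u a, (u, x, a) ∈ E) → (∃ u a, (u, y, a) ∈ E) → lt x y
  /-- targets are ordered by the labels of their incoming edges -/
  label_lt : ∀ u₁ v₁ a₁ u₂ v₂ a₂, (u₁, v₁, a₁) ∈ E → (u₂, v₂, a₂) ∈ E → a₁ < a₂ → lt v₁ v₂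
  /-- equally labelled edges preserve the order -/
  label_eq : ∀ u₁ v₁ a₁ u₂ v₂ a₂, (u₁, v₁, a₁) ∈ E → (u₂, v₂, a₂) ∈ E →
    a₁ = a₂ → lt u₁ u₂ → lt v₁ v₂ ∨ v₁ = v₂

/-- The graph with labelled edges `E` is a Wheeler graph. -/
def IsWheelerGraph {V A : Type} [LinearOrder A] (E : Finset (V × V × A)) : Prop :=
  ∃ lt : V → V → Prop, IsWheelerOrder E lt

/-! ### A word RAM

Programs are structured (assignments, stores, sequencing, conditionals, loops).  A program names
finitely many registers and finitely many random access arrays, each cell of which holds one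
machine word; words are the numbers below `W`, and arithmetic is performed modulo `W`.  Every
elementary operation (fetching a constant, a register or an array cell, one arithmetic operation
or comparison, one assignment, store, branch or loop test) costs one time unit. -/

namespace WordRAM

/-- The contents of the registers and of the arrays. -/
structure State where
  /-- `reg x` is the content of register number `x` -/
  reg : ℕ → ℕ
  /-- `arr a i` is the content of cell `i` of array number `a` -/
  arr : ℕ → ℕ → ℕ

/-- The arithmetic operations and comparisons. -/
inductive Op
  | add | sub | mul | div | mod | lt | eq

/-- Value of an operation before reduction modulo `W`.  Subtraction is truncated at zero,
comparisons return one for true and zero for false. -/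
def Op.eval : Op → ℕ → ℕ → ℕ
  | .add, x, y => x + y
  | .sub, x, y => x - y
  | .mul, x, y => x * y
  | .div, x, y => x / y
  | .mod, x, y => x % y
  | .lt, x, y => if x < y then 1 else 0
  | .eq, x, y => if x = y then 1 else 0

/-- Expressions: constants, registers, array cells, and operations applied to expressions. -/
inductive Expr
  | const (c : ℕ)
  | reg (x : ℕ)
  | get (a : ℕ) (i : Expr)
  | bin (o : Op) (e f : Expr)

/-- Value of an expression in a state, with words below `W`. -/
def Expr.eval (W : ℕ) (s : State) : Expr → ℕ
  | .const c => c % W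
  | .reg x => s.reg x
  | .get a i => s.arr a (i.eval W s)
  | .bin o e f => o.eval (e.eval W s) (f.eval W s) % W

/-- Time for evaluating an expression: the number of its nodes. -/
def Expr.cost : Expr → ℕ
  | .const _ => 1
  | .reg _ => 1
  | .get _ i => i.cost + 1
  | .bin _ e f => e.cost + f.cost + 1

/-- Programs. -/
inductive Prog
  /-- do nothing -/
  | skip
  /-- register `x` receives the value of `e` -/
  | assign (x : ℕ) (e : Expr)
  /-- cell `i` of array `a` receives the value of `e` -/
  | store (a : ℕ) (i e : Expr)
  /-- first `p`, then `q` -/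
  | seq (p q : Prog)
  /-- `p` if the value of `b` is nonzero, otherwise `q` -/
  | cond (b : Expr) (p q : Prog)
  /-- repeat `p` as long as the value of `b` is nonzero -/
  | loop (b : Expr) (p : Prog)

/-- The state after writing `v` to register `x`. -/
def State.setReg (s : State) (x v : ℕ) : State :=
  { s with reg := Function.update s.reg x v }

/-- The state after writing `v` to cell `i` of array `a`. -/
def State.setArr (s : State) (a i v : ℕ) : State :=
  { s with arr := Function.update s.arr a (Function.update (s.arr a) i v) }

/-- `Exec W p s s' t`: with words below `W`, the program `p` started in the state `s` halts in the
state `s'` after exactly `t` time units. -/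
inductive Exec (W : ℕ) : Prog → State → State → ℕ → Prop
  | skip (s : State) : Exec W .skip s s 1
  | assign (s : State) (x : ℕ) (e : Expr) :
      Exec W (.assign x e) s (s.setReg x (e.eval W s)) (e.cost + 1)
  | store (s : State) (a : ℕ) (i e : Expr) :
      Exec W (.store a i e) s (s.setArr a (i.eval W s) (e.eval W s)) (i.cost + e.cost + 1)
  | seq {p q : Prog} {s s' s'' : State} {t t' : ℕ} :
      Exec W p s s' t → Exec W q s' s'' t' → Exec W (.seq p q) s s'' (t + t')
  | cond_true {b : Expr} {p q : Prog} {s s' : State} {t : ℕ} :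
      b.eval W s ≠ 0 → Exec W p s s' t → Exec W (.cond b p q) s s' (b.cost + 1 + t)
  | cond_false {b : Expr} {p q : Prog} {s s' : State} {t : ℕ} :
      b.eval W s = 0 → Exec W q s s' t → Exec W (.cond b p q) s s' (b.cost + 1 + t)
  | loop_stop {b : Expr} {p : Prog} {s : State} :
      b.eval W s = 0 → Exec W (.loop b p) s s (b.cost + 1)
  | loop_step {b : Expr} {p : Prog} {s s' s'' : State} {t t' : ℕ} :
      b.eval W s ≠ 0 → Exec W p s s' t → Exec W (.loop b p) s' s'' t' →
      Exec W (.loop b p) s s'' (b.cost + 1 + t + t')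

end WordRAM

/-- The memory at the start of a computation on a `d`-NFA with states `0, …, n - 1` and letters
`0, …, k - 1` whose edges are listed in `l`.  Registers 0 to 3 hold the number of states, the number
of edges, the number of letters and the source; arrays 0, 1, 2 hold the origins, the targets and the
labels of the listed edges; array 3 marks the accepting states by ones.  All else is zero. -/
def DNFA.input {d n k : ℕ} (M : DNFA d (Fin n) (Fin k)) (l : List (Fin n × Fin n × Fin k)) :
    WordRAM.State where
  reg x := [n, l.length, k, (M.start : ℕ)].getD x 0
  arr
    | 0, i => (l.map fun e => (e.1 : ℕ)).getD i 0
    | 1, i => (l.map fun e => (e.2.1 : ℕ)).getD i 0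
    | 2, i => (l.map fun e => (e.2.2 : ℕ)).getD i 0
    | 3, i => if i ∈ M.accept.image (fun v : Fin n => (v : ℕ)) then 1 else 0
    | _, _ => 0

/-!
Let `(u₁, v₁, a)` and `(u₂, v₂, a)` be *linked* edges: equally labelled, with `u₁ ≠ u₂` and
`v₁ ≠ v₂`.  A Wheeler order satisfies `u₁ < u₂ ↔ v₁ < v₂`, since the defining implication may be
applied to the two edges in either order (`IsWheelerOrder.linked_iff`).  So "`u` precedes `v`", for
all pairs of states, is a system of truth values subject to equalities, and to the values which are
dictated by the source and by the labels of incoming edges.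

*Transitivity is automatic.*  Fix a spanning tree rooted at the source.  If an orientation of the
pairs that satisfies these constraints had a cyclic triple of states, then its parents would be a
cyclic triple as well, and the triple would climb the tree for ever.  The only obstruction would be
three equally labelled edges out of one parent, and out-degree two excludes them
(`IsSpanningTree.not_cyclic`, `IsSpanningTree.isWheelerOrder`).

*Few variables.*  Climbing the tree also shows that the truth value of any pair is a constant or is
that of a pair of siblings with equally labelled tree edges.  A state has at most one such sibling,
so that every pair of states gets a literal in `n` variables (`pairLit`).  What remains are at most
`|E|²` equations between literals.  They are solved by keeping a substitution of literals
(`IsSubst`): an equation between different literals either is contradictory, or leads to a merge,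
which rewrites the table of the substitution in time `O(n)` and lowers its number of values
(`IsSubst.card_image_merge_lt`).  As there are `O(n)` merges and `n ≤ |E| + 1`, the total time is
`O(|E|²)`.  At the end, any values of the remaining variables give a Wheeler order
(`IsSpanningTree.isWheelerOrder_of_subst`); conversely a Wheeler order is a model of all equations
(`IsSpanningTree.exists_assignment`), which rules out a contradiction.

The program `WordRAM.wheelerSort` searches the automaton from the source for a spanning tree,
tabulates the literals, solves the equations, and lists every state at the position given by the
number of its predecessors.  Its correctness and running time are proved with the predicate
`WordRAM.Runs`, whose loop rule allows invariants that mention the elapsed time; this is how the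
merges are amortized.
-/

/-! ### Orders on the states of an automaton with a spanning tree -/

section Automata

variable {d : ℕ} {V A : Type}

/-- A spanning tree of the automaton, rooted at the source: every other state `v` has a parent
`par v`, from which an edge labelled `lb v` leads to `v`.  The positions `pos` make the parent
relation well-founded.  The labels `lb v` are natural numbers, because the source has none, and
`Fin k` may be empty. -/
structure IsSpanningTree {k : ℕ} (M : DNFA d V (Fin k)) (par : V → V) (lb : V → ℕ)
    (pos : V → ℕ) : Prop where
  edge : ∀ v, v ≠ M.start → ∃ a : Fin k, lb v = a ∧ (par v, v, a) ∈ M.edges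
  pos_lt : ∀ v, v ≠ M.start → pos (par v) < pos v

/-- All edges into a state carry the same label. -/
def IsInputConsistent (E : Finset (V × V × A)) : Prop :=
  ∀ e ∈ E, ∀ f ∈ E, e.2.1 = f.2.1 → e.2.2 = f.2.2

/-- Two equally labelled edges with different origins and different targets.  A Wheeler order
compares the origins in the same way as the targets. -/
def AreLinked (e f : V × V × A) : Prop :=
  e.2.2 = f.2.2 ∧ e.1 ≠ f.1 ∧ e.2.1 ≠ f.2.1

theorem DNFA.ne_start {M : DNFA d V A} {u v : V} {a : A} (h : (u, v, a) ∈ M.edges) :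
    v ≠ M.start := fun hv => (M.no_in_edge_iff v).2 hv ⟨u, a, h⟩

theorem IsInputConsistent.eq_label {k : ℕ} {M : DNFA d V (Fin k)} {par : V → V} {lb : V → ℕ}
    {pos : V → ℕ} (hE : IsInputConsistent M.edges) (hT : IsSpanningTree M par lb pos) {u v : V}
    {a : Fin k} (h : (u, v, a) ∈ M.edges) : (a : ℕ) = lb v := by
  obtain ⟨b, hb, h'⟩ := hT.edge v (DNFA.ne_start h)
  obtain rfl : a = b := hE _ h _ h' rfl
  exact hb.symm

theorem DNFA.targets_eq {M : DNFA 2 V A} {u x y z : V} {a : A} (hx : (u, x, a) ∈ M.edges)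
    (hy : (u, y, a) ∈ M.edges) (hz : (u, z, a) ∈ M.edges) : x = y ∨ x = z ∨ y = z := by
  by_contra! h
  have hfin : {e | e ∈ M.edges ∧ e.1 = u ∧ e.2.2 = a}.Finite :=
    M.edges.finite_toSet.subset fun e he => he.1
  have := M.out_le u a
  have h3 := (Set.two_lt_ncard_iff hfin).2 ⟨(u, x, a), (u, y, a), (u, z, a), ⟨hx, rfl, rfl⟩,
    ⟨hy, rfl, rfl⟩, ⟨hz, rfl, rfl⟩, by simp [h.1], by simp [h.2.1], by simp [h.2.2]⟩
  omega

section Orientation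

variable {k : ℕ} {M : DNFA 2 V (Fin k)} {par : V → V} {lb pos : V → ℕ} {R : V → V → Prop}

/-- A cyclic triple is carried to the parents of its three states, so that it climbs the spanning
tree for ever.  The parents cannot all agree, because at most two edges with a given label leave a
state, and if just two of them agree then linked edges are oriented differently. -/
theorem IsSpanningTree.not_cyclic (hT : IsSpanningTree M par lb pos)
    (hasymm : ∀ u v, R u v → ¬ R v u) (hsource : ∀ v, v ≠ M.start → R M.start v)
    (hlab : ∀ u v, u ≠ M.start → v ≠ M.start → lb u < lb v → R u v)
    (hlink : ∀ e ∈ M.edges, ∀ f ∈ M.edges, AreLinked e f → (R e.1 f.1 ↔ R e.2.1 f.2.1))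
    (x y z : V) (hxy : R x y) (hyz : R y z) : ¬ R z x := by
  induction hN : pos x using Nat.strong_induction_on generalizing x y z with
  | _ N ih =>
  subst hN
  intro hzx
  have hirr : ∀ v, ¬ R v v := fun v h => hasymm v v h h
  have hne : ∀ {u v}, R u v → u ≠ v := fun h e => hirr _ (e ▸ h)
  have hroot : ∀ {u v}, R u v → v ≠ M.start := by
    rintro u v h rfl
    exact hasymm _ _ h (hsource u (hne h))
  have hle : ∀ {u v}, R u v → u ≠ M.start → lb u ≤ lb v := by
    intro u v h hu
    by_contra! hlt
    exact hasymm _ _ h (hlab _ _ (hroot h) hu hlt)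
  have hx := hroot hzx
  have hy := hroot hxy
  have hz := hroot hyz
  have l1 := hle hxy hx
  have l2 := hle hyz hy
  have l3 := hle hzx hz
  have e1 : lb x = lb y := le_antisymm l1 (l2.trans l3)
  have e2 : lb y = lb z := le_antisymm l2 (l3.trans l1)
  obtain ⟨a, hax, ex⟩ := hT.edge x hx
  obtain ⟨b, hby, ey⟩ := hT.edge y hy
  obtain ⟨c, hcz, ez⟩ := hT.edge z hz
  obtain rfl : a = b := Fin.ext (by omega)
  obtain rfl : a = c := Fin.ext (by omega)
  have up : ∀ {u v}, u ≠ M.start → v ≠ M.start → lb u = lb v → R u v → par u ≠ par v →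
      R (par u) (par v) := by
    intro u v hu hv hl h hp
    obtain ⟨a, ha, eu⟩ := hT.edge u hu
    obtain ⟨b, hb, ev⟩ := hT.edge v hv
    exact (hlink _ eu _ ev ⟨Fin.ext (ha.symm.trans (hl.trans hb)), hp, hne h⟩).2 h
  have u1 := up hx hy e1 hxy
  have u2 := up hy hz e2 hyz
  have u3 := up hz hx (e1.trans e2).symm hzx
  by_cases p1 : par x = par y
  · by_cases p2 : par y = par z
    · rw [← p1] at ey
      rw [← p2, ← p1] at ez
      rcases DNFA.targets_eq ex ey ez with h | h | h
      · exact hne hxy h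
      · exact hne hzx h.symm
      · exact hne hyz h
    · exact hasymm _ _ (u2 p2) (p1 ▸ u3 (fun h => p2 (p1 ▸ h.symm)))
  · by_cases p2 : par y = par z
    · exact hasymm _ _ (u1 p1) (p2 ▸ u3 (fun h => p1 (p2 ▸ h.symm)))
    · by_cases p3 : par z = par x
      · exact hasymm _ _ (u1 p1) (p3 ▸ u2 p2)
      · exact ih _ (hT.pos_lt x hx) _ _ _ (u1 p1) (u2 p2) rfl (u3 p3)

/-- Transitivity need not be asked for: an orientation of all pairs of states which puts the source
first, respects the labels, and agrees on linked edges is a Wheeler order. -/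
theorem IsSpanningTree.isWheelerOrder (hT : IsSpanningTree M par lb pos)
    (hE : IsInputConsistent M.edges)
    (hasymm : ∀ u v, R u v → ¬ R v u) (htot : ∀ u v, u ≠ v → R u v ∨ R v u)
    (hsource : ∀ v, v ≠ M.start → R M.start v)
    (hlab : ∀ u v, u ≠ M.start → v ≠ M.start → lb u < lb v → R u v)
    (hlink : ∀ e ∈ M.edges, ∀ f ∈ M.edges, AreLinked e f → (R e.1 f.1 ↔ R e.2.1 f.2.1)) :
    IsWheelerOrder M.edges R where
  total :=
    { trichotomous := fun a b h1 h2 => by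
        by_contra h
        exact (htot a b h).elim h1 h2
      irrefl := fun a h => hasymm a a h h
      trans := fun a b c h1 h2 => by
        have h3 := hT.not_cyclic hasymm hsource hlab hlink a b c h1 h2
        by_cases hac : a = c
        · exact absurd h1 (hac ▸ hasymm _ _ h2)
        · exact (htot a c hac).resolve_right h3 }
  source_first := by
    rintro x y hx ⟨u, a, hy⟩
    rw [(M.no_in_edge_iff x).1 hx]
    exact hsource y (DNFA.ne_start hy)
  label_lt := by
    intro u₁ v₁ a₁ u₂ v₂ a₂ h1 h2 h
    rw [Fin.lt_def, hE.eq_label hT h1, hE.eq_label hT h2] at h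
    exact hlab _ _ (DNFA.ne_start h1) (DNFA.ne_start h2) h
  label_eq := by
    intro u₁ v₁ a₁ u₂ v₂ a₂ h1 h2 h hu
    by_cases hv : v₁ = v₂
    · exact Or.inr hv
    · refine Or.inl ((hlink _ h1 _ h2 ⟨h, ?_, hv⟩).1 hu)
      intro e
      change u₁ = u₂ at e
      subst e
      exact hasymm _ _ hu hu

end Orientation

namespace IsWheelerOrder

variable [LinearOrder A] {E : Finset (V × V × A)} {lt : V → V → Prop}

theorem asymm (h : IsWheelerOrder E lt) {u v : V} (huv : lt u v) : ¬ lt v u := fun hvu =>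
  h.total.irrefl u (h.total.trans _ _ _ huv hvu)

theorem not_iff (h : IsWheelerOrder E lt) {u v : V} (huv : u ≠ v) : lt v u ↔ ¬ lt u v :=
  ⟨h.asymm, fun h1 => by
    by_contra h2
    exact huv (h.total.trichotomous _ _ h1 h2)⟩

theorem isInputConsistent (h : IsWheelerOrder E lt) : IsInputConsistent E := by
  rintro ⟨u, v, a⟩ he ⟨u', v', a'⟩ hf hv
  change v = v' at hv
  subst hv
  rcases lt_trichotomy a a' with hlt | heq | hlt
  · exact absurd (h.label_lt _ _ _ _ _ _ he hf hlt) (h.total.irrefl v)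
  · exact heq
  · exact absurd (h.label_lt _ _ _ _ _ _ hf he hlt) (h.total.irrefl v)

theorem linked_iff (h : IsWheelerOrder E lt) {e f : V × V × A} (he : e ∈ E) (hf : f ∈ E)
    (hef : AreLinked e f) : lt e.1 f.1 ↔ lt e.2.1 f.2.1 := by
  constructor
  · intro hlt
    exact (h.label_eq _ _ _ _ _ _ he hf hef.1 hlt).resolve_right hef.2.2
  · intro hlt
    by_contra hn
    rw [← h.not_iff hef.2.1] at hn
    exact ((h.label_eq _ _ _ _ _ _ hf he hef.1.symm hn).resolve_right hef.2.2.symm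
      |> h.asymm) hlt

end IsWheelerOrder

end Automata

/-! ### Literals and substitutions -/

/-- The complementary literal.  Literals are numbers: `0` is false, `1` is true, and `2 * i + 2`,
`2 * i + 3` are variable number `i` and its negation. -/
def negLit (c : ℕ) : ℕ := if c % 2 = 0 then c + 1 else c - 1

theorem negLit_negLit (c : ℕ) : negLit (negLit c) = c := by
  unfold negLit; split_ifs <;> omega

theorem negLit_ne (c : ℕ) : negLit c ≠ c := by
  unfold negLit; split_ifs <;> omega

theorem negLit_mod (c : ℕ) : negLit c % 2 = 1 ↔ ¬ c % 2 = 1 := by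
  unfold negLit; split_ifs <;> omega

theorem negLit_lt {c N : ℕ} (h : c < 2 * N + 2) : negLit c < 2 * N + 2 := by
  unfold negLit; split_ifs <;> omega

theorem two_le_negLit {c : ℕ} (h : 2 ≤ c) : 2 ≤ negLit c := by
  unfold negLit; split_ifs <;> omega

theorem eq_negLit_comm {c c' : ℕ} : c = negLit c' ↔ negLit c = c' :=
  ⟨fun h => by rw [h, negLit_negLit], fun h => by rw [← h, negLit_negLit]⟩

/-- A truth assignment, as the set of true literals. -/
structure IsAssignment (ρ : ℕ → Prop) : Prop where
  zero : ¬ ρ 0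
  neg : ∀ c, ρ (negLit c) ↔ ¬ ρ c

/-- A map of the literals in `N` variables to themselves which commutes with negation and preserves
the truth values. -/
structure IsSubst (N : ℕ) (σ : ℕ → ℕ) : Prop where
  lt : ∀ c < 2 * N + 2, σ c < 2 * N + 2
  neg : ∀ c < 2 * N + 2, σ (negLit c) = negLit (σ c)
  zero : σ 0 = 0

theorem IsSubst.one {N : ℕ} {σ : ℕ → ℕ} (h : IsSubst N σ) : σ 1 = 1 := by
  have := h.neg 0 (by omega)
  rw [h.zero] at this
  exact this

theorem isSubst_id {N : ℕ} {σ : ℕ → ℕ} (h : ∀ c < 2 * N + 2, σ c = c) : IsSubst N σ where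
  lt c hc := by rw [h c hc]; exact hc
  neg c hc := by rw [h c hc, h _ (negLit_lt hc)]
  zero := h 0 (by omega)

/-- The substitution `σ`, followed by replacing `c` by `d` and `c'` by `d'`. -/
def mergeLit (σ : ℕ → ℕ) (c c' d d' : ℕ) (x : ℕ) : ℕ :=
  if σ x = c then d else if σ x = c' then d' else σ x

section Merge

variable {N c d : ℕ} {σ σ' : ℕ → ℕ}

theorem IsSubst.merge (h : IsSubst N σ)
    (hσ' : ∀ x < 2 * N + 2, σ' x = mergeLit σ c (negLit c) d (negLit d) x)
    (hc : 2 ≤ c) (hd : d < 2 * N + 2) : IsSubst N σ' where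
  lt x hx := by
    rw [hσ' x hx]
    unfold mergeLit
    have := negLit_lt hd
    have := h.lt x hx
    split_ifs <;> assumption
  neg x hx := by
    rw [hσ' x hx, hσ' _ (negLit_lt hx)]
    unfold mergeLit
    rw [h.neg x hx]
    have := negLit_ne c
    by_cases h1 : σ x = c
    · simp [h1, this]
    · by_cases h2 : σ x = negLit c
      · simp [h2, negLit_negLit, this]
      · have h3 : negLit (σ x) ≠ c := fun e => h2 (eq_negLit_comm.2 e)
        have h4 : negLit (σ x) ≠ negLit c := fun e => h1 (by
          rw [← negLit_negLit (σ x), e, negLit_negLit])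
        simp [h1, h2, h3, h4]
  zero := by
    rw [hσ' 0 (by omega)]
    unfold mergeLit
    have := two_le_negLit hc
    rw [h.zero, if_neg (by omega), if_neg (by omega)]

theorem mergeLit_congr {x y : ℕ} {c' d' : ℕ} (h : σ x = σ y) :
    mergeLit σ c c' d d' x = mergeLit σ c c' d d' y := by
  unfold mergeLit; rw [h]

theorem mergeLit_eq {x y : ℕ} (hx : σ x = c) (hy : σ y = d) (h1 : d ≠ c) (h2 : d ≠ negLit c) :
    mergeLit σ c (negLit c) d (negLit d) x = mergeLit σ c (negLit c) d (negLit d) y := by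
  unfold mergeLit; simp [hx, hy, h1, h2]

theorem IsAssignment.mergeLit_iff {ρ : ℕ → Prop} (hρ : IsAssignment ρ) (hcd : ρ c ↔ ρ d) {x : ℕ}
    (hx : ρ (σ x) ↔ ρ x) : ρ (mergeLit σ c (negLit c) d (negLit d) x) ↔ ρ x := by
  rw [← hx]
  unfold mergeLit
  split_ifs with h1 h2
  · rw [h1, hcd]
  · rw [h2, hρ.neg, hρ.neg, hcd]
  · rfl

/-- Every merge of different literals shrinks the set of values of the substitution; this bounds the
number of merges. -/
theorem IsSubst.card_image_merge_lt (h : IsSubst N σ)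
    (hσ' : ∀ x < 2 * N + 2, σ' x = mergeLit σ c (negLit c) d (negLit d) x)
    {x y : ℕ} (hx : x < 2 * N + 2) (hy : y < 2 * N + 2) (hxc : σ x = c) (hyd : σ y = d)
    (h1 : d ≠ c) (h2 : d ≠ negLit c) :
    ((Finset.range (2 * N + 2)).image σ').card < ((Finset.range (2 * N + 2)).image σ).card := by
  have h3 : negLit d ≠ c := fun e => h2 (eq_negLit_comm.2 e)
  have hmem : c ∈ (Finset.range (2 * N + 2)).image σ :=
    Finset.mem_image.2 ⟨x, Finset.mem_range.2 hx, hxc⟩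
  refine lt_of_le_of_lt (Finset.card_le_card ?_) (Finset.card_erase_lt_of_mem hmem)
  intro w hw
  obtain ⟨z, hz, rfl⟩ := Finset.mem_image.1 hw
  rw [Finset.mem_range] at hz
  rw [hσ' z hz, Finset.mem_erase]
  unfold mergeLit
  split_ifs with h4 h5
  · exact ⟨h1, Finset.mem_image.2 ⟨y, Finset.mem_range.2 hy, hyd⟩⟩
  · exact ⟨h3, Finset.mem_image.2 ⟨negLit y, Finset.mem_range.2 (negLit_lt hy), by
      rw [h.neg y hy, hyd]⟩⟩
  · exact ⟨h4, Finset.mem_image.2 ⟨z, Finset.mem_range.2 hz, rfl⟩⟩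

end Merge

/-! ### The literal of a pair of states -/

section Code

variable {n k : ℕ} {M : DNFA 2 (Fin n) (Fin k)} {par : Fin n → Fin n} {lb : Fin n → ℕ}
  {pos : Fin n → ℕ} {T : Fin n → Fin n → ℕ}

/-- The literal for the statement that `u` precedes `v`, in terms of the literals `T` of the pair of
parents: decided by the source or by the labels, or inherited from the parents if these differ.
For siblings it is variable number `min u v` or its negation. -/
def pairLit (s : Fin n) (par : Fin n → Fin n) (lb : Fin n → ℕ) (T : Fin n → Fin n → ℕ)
    (u v : Fin n) : ℕ :=
  if u = v then 0
  else if u = s then 1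
  else if v = s then 0
  else if lb u < lb v then 1
  else if lb v < lb u then 0
  else if par u = par v then (if u < v then 2 * (u : ℕ) + 2 else 2 * (v : ℕ) + 3)
  else T (par u) (par v)

theorem pairLit_congr {s : Fin n} {T T' : Fin n → Fin n → ℕ} {u v : Fin n}
    (h : u ≠ s → T (par u) (par v) = T' (par u) (par v)) :
    pairLit s par lb T u v = pairLit s par lb T' u v := by
  unfold pairLit
  split_ifs with h1 h2 <;> first | rfl | exact h h2

/-- Induction on pairs of states along the spanning tree. -/
theorem IsSpanningTree.pair_induction (hT : IsSpanningTree M par lb pos)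
    {p : Fin n → Fin n → Prop}
    (h : ∀ u v, (u ≠ M.start → v ≠ M.start → par u ≠ par v → p (par u) (par v)) → p u v)
    (u v : Fin n) : p u v := by
  induction hN : pos u using Nat.strong_induction_on generalizing u v with
  | _ N ih =>
    subst hN
    exact h u v fun hu _ _ => ih _ (hT.pos_lt u hu) _ _ rfl

theorem IsSpanningTree.pairLit_lt (hT : IsSpanningTree M par lb pos)
    (hc : ∀ u v, T u v = pairLit M.start par lb T u v) (u v : Fin n) : T u v < 2 * n + 2 := by
  refine hT.pair_induction (p := fun u v => T u v < 2 * n + 2) (fun u v ih => ?_) u v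
  rw [hc u v]
  unfold pairLit
  have := u.2
  have := v.2
  split_ifs with h1 h2 h3 h4 h5 h6 h7 <;> omega

theorem IsSpanningTree.pairLit_swap (hT : IsSpanningTree M par lb pos)
    (hc : ∀ u v, T u v = pairLit M.start par lb T u v) (u v : Fin n) (huv : u ≠ v) :
    T v u = negLit (T u v) := by
  refine hT.pair_induction (p := fun u v => u ≠ v → T v u = negLit (T u v))
    (fun u v ih huv => ?_) u v huv
  rw [hc u v, hc v u]
  unfold pairLit
  by_cases hu : u = M.start
  · subst hu; simp [huv, huv.symm, negLit]
  by_cases hv : v = M.start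
  · subst hv; simp [huv, huv.symm, negLit]
  rcases lt_trichotomy (lb u) (lb v) with hl | hl | hl
  · simp [huv, huv.symm, hu, hv, hl, hl.le, negLit]
  · by_cases hp : par u = par v
    · rcases lt_or_gt_of_ne huv with h | h
      · simp [huv, huv.symm, hu, hv, hl, hp, h, not_lt.2 h.le, negLit]
      · simp [huv, huv.symm, hu, hv, hl, hp, h, not_lt.2 h.le, negLit]
    · simp only [huv, huv.symm, hu, hv, hl, hp, Ne.symm hp, lt_irrefl, if_false]
      exact ih hu hv hp hp
  · simp [huv, huv.symm, hu, hv, hl, not_lt.2 hl.le, negLit]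

/-- A Wheeler order gives a truth assignment.  It is well defined, because a state has at most one
sibling with the same incoming label. -/
theorem IsSpanningTree.exists_assignment (hT : IsSpanningTree M par lb pos)
    (hc : ∀ u v, T u v = pairLit M.start par lb T u v) {lt : Fin n → Fin n → Prop}
    (h : IsWheelerOrder M.edges lt) :
    ∃ ρ, IsAssignment ρ ∧ ∀ u v, u ≠ v → (ρ (T u v) ↔ lt u v) := by
  -- `f i` says that state number `i` precedes its larger sibling
  let f : ℕ → Prop := fun i => ∃ u v : Fin n, (u : ℕ) = i ∧ u < v ∧ u ≠ M.start ∧ v ≠ M.start ∧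
    lb u = lb v ∧ par u = par v ∧ lt u v
  have hf : ∀ u v : Fin n, u < v → u ≠ M.start → v ≠ M.start → lb u = lb v → par u = par v →
      (f u ↔ lt u v) := by
    intro u v huv hu hv hl hp
    refine ⟨?_, fun hlt => ⟨u, v, rfl, huv, hu, hv, hl, hp, hlt⟩⟩
    rintro ⟨u', w, e, huw, -, hw, hl', hp', hlt⟩
    obtain rfl := Fin.ext e
    obtain ⟨a, ha, e1⟩ := hT.edge u' hu
    obtain ⟨b, hb, e2⟩ := hT.edge v hv
    obtain ⟨c, hc, e3⟩ := hT.edge w hw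
    obtain rfl : a = b := Fin.ext (by omega)
    obtain rfl : a = c := Fin.ext (by omega)
    rw [← hp] at e2
    rw [← hp'] at e3
    rcases DNFA.targets_eq e1 e2 e3 with h | h | h
    · exact absurd h huv.ne
    · exact absurd h huw.ne
    · exact h ▸ hlt
  let ρ : ℕ → Prop := fun c => if c < 2 then c = 1 else (f ((c - 2) / 2) ↔ c % 2 = 0)
  refine ⟨ρ, ⟨by simp [ρ], ?_⟩, ?_⟩
  · intro c
    rcases Nat.lt_or_ge c 2 with h2 | h2
    · interval_cases c <;> simp [ρ, negLit]
    · have h3 := two_le_negLit h2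
      have h4 : (negLit c - 2) / 2 = (c - 2) / 2 := by unfold negLit; split_ifs <;> omega
      have h5 : negLit c % 2 = 0 ↔ ¬ c % 2 = 0 := by unfold negLit; split_ifs <;> omega
      simp only [ρ, not_lt.2 h2, not_lt.2 h3, if_false, h4, h5]
      by_cases h6 : c % 2 = 0 <;> simp [h6]
  · have ρ0 : ¬ ρ 0 := by simp [ρ]
    have ρ1 : ρ 1 := by simp [ρ]
    have hs : ∀ v, v ≠ M.start → lt M.start v := fun v hv =>
      let ⟨a, _, hv⟩ := hT.edge v hv
      h.source_first _ _ ((M.no_in_edge_iff _).2 rfl) ⟨_, a, hv⟩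
    have hl : ∀ u v, u ≠ M.start → v ≠ M.start → lb u < lb v → lt u v := by
      intro u v hu hv hl
      obtain ⟨a, ha, eu⟩ := hT.edge u hu
      obtain ⟨b, hb, ev⟩ := hT.edge v hv
      exact h.label_lt _ _ _ _ _ _ eu ev (by rw [Fin.lt_def]; omega)
    intro u v
    refine hT.pair_induction (p := fun u v => u ≠ v → (ρ (T u v) ↔ lt u v)) ?_ u v
    intro u v ih huv
    rw [hc u v]
    unfold pairLit
    split_ifs with h1 h2 h3 h4 h5 h6 h7
    · subst h1; exact absurd rfl huv
    · subst h2; exact iff_of_true ρ1 (hs v (Ne.symm huv))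
    · subst h3; exact iff_of_false ρ0 (h.asymm (hs u huv))
    · exact iff_of_true ρ1 (hl u v h2 h3 h4)
    · exact iff_of_false ρ0 (h.asymm (hl v u h3 h2 h5))
    · have hl := le_antisymm (not_lt.1 h5) (not_lt.1 h4)
      rw [← hf u v h7 h2 h3 hl h6]
      have e : (2 * (u : ℕ) + 2) % 2 = 0 := by omega
      simp [ρ, e]
    · have hl := le_antisymm (not_lt.1 h5) (not_lt.1 h4)
      have h8 : v < u := lt_of_le_of_ne (not_lt.1 h7) (Ne.symm huv)
      rw [h.not_iff (Ne.symm huv), ← hf v u h8 h3 h2 hl.symm h6.symm]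
      have e : (2 * (v : ℕ) + 3) % 2 = 1 := by omega
      have e' : (2 * (v : ℕ) + 1) / 2 = v := by omega
      simp [ρ, e, e']
    · have hl := le_antisymm (not_lt.1 h5) (not_lt.1 h4)
      rw [ih h2 h3 h6 h6]
      obtain ⟨a, ha, eu⟩ := hT.edge u h2
      obtain ⟨b, hb, ev⟩ := hT.edge v h3
      exact h.linked_iff eu ev ⟨Fin.ext (ha.symm.trans (hl.trans hb)), h6, huv⟩

/-- A substitution which identifies the literals of linked edges yields a Wheeler order: the
remaining variables may be given any values. -/
theorem IsSpanningTree.isWheelerOrder_of_subst (hT : IsSpanningTree M par lb pos)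
    (hE : IsInputConsistent M.edges) (hc : ∀ u v, T u v = pairLit M.start par lb T u v)
    {σ : ℕ → ℕ} (hσ : IsSubst n σ)
    (hlink : ∀ e ∈ M.edges, ∀ f ∈ M.edges, AreLinked e f →
      σ (T e.1 f.1) = σ (T e.2.1 f.2.1)) :
    IsWheelerOrder M.edges fun u v => σ (T u v) % 2 = 1 := by
  have hswap : ∀ u v, u ≠ v → (σ (T v u) % 2 = 1 ↔ ¬ σ (T u v) % 2 = 1) := by
    intro u v huv
    rw [hT.pairLit_swap hc u v huv, hσ.neg _ (hT.pairLit_lt hc u v), negLit_mod]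
  have hirr : ∀ u, ¬ σ (T u u) % 2 = 1 := by
    intro u
    rw [hc u u]
    simp [pairLit, hσ.zero]
  refine hT.isWheelerOrder hE ?_ ?_ ?_ ?_ ?_
  · intro u v h
    by_cases huv : u = v
    · subst huv; exact absurd h (hirr u)
    · rw [hswap u v huv, not_not]; exact h
  · intro u v huv
    rw [hswap u v huv]
    exact em _
  · intro v hv
    rw [hc]
    simp [pairLit, Ne.symm hv, hσ.one]
  · intro u v hu hv hl
    have huv : u ≠ v := fun e => hl.ne (e ▸ rfl)
    rw [hc]
    simp [pairLit, hu, hv, hl, huv, hσ.one]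
  · intro e he f hf hef
    simp only [hlink e he f hf hef]

end Code

/-! ### Reasoning about word RAM programs -/

namespace WordRAM

variable {W : ℕ}

/-- Started in the state `s`, the program `p` halts, and the final state and the running time
satisfy `Q`. -/
def Runs (W : ℕ) (p : Prog) (Q : State → ℕ → Prop) (s : State) : Prop :=
  ∃ s' t, Exec W p s s' t ∧ Q s' t

theorem Runs.mono {p : Prog} {Q Q' : State → ℕ → Prop} {s : State} (h : Runs W p Q s)
    (hQ : ∀ s' t, Q s' t → Q' s' t) : Runs W p Q' s :=
  let ⟨s', t, he, hq⟩ := h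
  ⟨s', t, he, hQ s' t hq⟩

theorem Runs.skip {Q : State → ℕ → Prop} {s : State} (h : Q s 1) : Runs W .skip Q s :=
  ⟨s, 1, .skip s, h⟩

theorem Runs.assign {Q : State → ℕ → Prop} {s : State} {x : ℕ} {e : Expr}
    (h : Q (s.setReg x (e.eval W s)) (e.cost + 1)) : Runs W (.assign x e) Q s :=
  ⟨_, _, .assign s x e, h⟩

theorem Runs.store {Q : State → ℕ → Prop} {s : State} {a : ℕ} {i e : Expr}
    (h : Q (s.setArr a (i.eval W s) (e.eval W s)) (i.cost + e.cost + 1)) :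
    Runs W (.store a i e) Q s :=
  ⟨_, _, .store s a i e, h⟩

theorem Runs.seq {Q : State → ℕ → Prop} {s : State} {p q : Prog}
    (h : Runs W p (fun s' t => Runs W q (fun s'' t' => Q s'' (t + t')) s') s) :
    Runs W (.seq p q) Q s :=
  let ⟨_, _, h1, _, _, h2, hq⟩ := h
  ⟨_, _, .seq h1 h2, hq⟩

theorem Runs.cond {Q : State → ℕ → Prop} {s : State} {b : Expr} {p q : Prog}
    (hp : b.eval W s ≠ 0 → Runs W p (fun s' t => Q s' (b.cost + 1 + t)) s)
    (hq : b.eval W s = 0 → Runs W q (fun s' t => Q s' (b.cost + 1 + t)) s) :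
    Runs W (.cond b p q) Q s := by
  by_cases hb : b.eval W s = 0
  · obtain ⟨_, _, h, hQ⟩ := hq hb
    exact ⟨_, _, .cond_false hb h, hQ⟩
  · obtain ⟨_, _, h, hQ⟩ := hp hb
    exact ⟨_, _, .cond_true hb h, hQ⟩

/-- Run `p` with register `x` holding `0, 1, …`, as long as this number is below the content of
register `y`. -/
def Prog.forLt (x y : ℕ) (p : Prog) : Prog :=
  .seq (.assign x (.const 0)) (.loop (.bin .lt (.reg x) (.reg y))
    (.seq p (.assign x (.bin .add (.reg x) (.const 1)))))

@[simp] theorem State.setReg_reg (s : State) (x v y : ℕ) :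
    (s.setReg x v).reg y = if y = x then v else s.reg y := by
  simp [State.setReg, Function.update_apply]

@[simp] theorem State.setReg_arr (s : State) (x v : ℕ) : (s.setReg x v).arr = s.arr := rfl

@[simp] theorem State.setArr_reg (s : State) (a i v : ℕ) : (s.setArr a i v).reg = s.reg := rfl

@[simp] theorem State.setArr_arr (s : State) (a i v b : ℕ) :
    (s.setArr a i v).arr b = if b = a then Function.update (s.arr a) i v else s.arr b := by
  simp only [State.setArr, Function.update_apply]

/-- The invariant `I i s t` is to hold, after `t` time units, in the state `s` reached when round
number `i` is about to start; it may mention the time in order to allow for amortized bounds. -/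
theorem Runs.forLt {Q : State → ℕ → Prop} {s : State} {x y N : ℕ} {p : Prog} (hN : N < W)
    (hW : 1 < W) (I : ℕ → State → ℕ → Prop)
    (hy : ∀ i s t, I i s t → s.reg y = N) (h0 : I 0 (s.setReg x 0) 2)
    (hstep : ∀ i < N, ∀ s t, I i s t → s.reg x = i →
      Runs W p (fun s' t' => s'.reg x = i ∧ I (i + 1) (s'.setReg x (i + 1)) (t + t' + 8)) s)
    (hQ : ∀ s t, I N s t → Q s (t + 4)) : Runs W (.forLt x y p) Q s := by
  have key : ∀ m i s t, N = i + m → I i s t → s.reg x = i →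
      Runs W (.loop (.bin .lt (.reg x) (.reg y))
        (.seq p (.assign x (.bin .add (.reg x) (.const 1))))) (fun s' t' => Q s' (t + t')) s := by
    intro m
    induction m with
    | zero =>
      intro i s t hi hI hx
      obtain rfl : N = i := hi
      refine ⟨s, _, Exec.loop_stop ?_, hQ s t hI⟩
      simp [Expr.eval, Op.eval, hx, hy _ _ _ hI]
    | succ m ih =>
      intro i s t hi hI hx
      obtain ⟨s', t', he, hx', hI'⟩ := hstep i (by omega) s t hI hx
      have hv : (Expr.bin .add (.reg x) (.const 1)).eval W s' = i + 1 := by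
        simp only [Expr.eval, Op.eval, hx', Nat.mod_eq_of_lt hW]
        exact Nat.mod_eq_of_lt (by omega)
      obtain ⟨s'', t'', he', hQ'⟩ := ih (i + 1) (s'.setReg x (i + 1)) _ (by omega) hI' (by simp)
      refine ⟨s'', _, .loop_step ?_ (.seq he (.assign s' x _)) (hv ▸ he'), ?_⟩
      · have hlt : i < N := by omega
        simp [Expr.eval, Op.eval, hx, hy _ _ _ hI, hlt, Nat.mod_eq_of_lt hW]
      · convert hQ' using 1
        simp [Expr.cost]
        omega
  refine Runs.seq (Runs.assign ?_)
  have h00 : (Expr.const 0).eval W s = 0 := by simp [Expr.eval]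
  rw [h00]
  exact key N 0 _ _ (by omega) h0 (by simp)

/-- A loop whose rounds take at most `B` time units each. -/
theorem Runs.forLt_le {Q : State → ℕ → Prop} {s : State} {x y N : ℕ} {p : Prog} (hN : N < W)
    (hW : 1 < W) (B : ℕ) (I : ℕ → State → Prop)
    (hy : ∀ i s, I i s → s.reg y = N) (h0 : I 0 (s.setReg x 0))
    (hstep : ∀ i < N, ∀ s, I i s → s.reg x = i →
      Runs W p (fun s' t' => t' ≤ B ∧ s'.reg x = i ∧ I (i + 1) (s'.setReg x (i + 1))) s)
    (hQ : ∀ s t, t ≤ N * (B + 8) + 6 → I N s → Q s t) : Runs W (.forLt x y p) Q s := by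
  refine Runs.forLt hN hW (fun i s t => t ≤ i * (B + 8) + 2 ∧ I i s) (fun i s t h => hy i s h.2)
    ⟨by omega, h0⟩ ?_ (fun s t h => hQ s _ (by omega) h.2)
  rintro i hi s t ⟨ht, hI⟩ hx
  refine (hstep i hi s hI hx).mono ?_
  rintro s' t' ⟨h1, h2, h3⟩
  refine ⟨h2, ?_, h3⟩
  rw [add_mul]
  omega

theorem Expr.eval_const {s : State} {c : ℕ} (h : c < W) : (Expr.const c).eval W s = c :=
  Nat.mod_eq_of_lt h

theorem Expr.eval_eq_ne_zero {s : State} {e f : Expr} (hW : 1 < W) :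
    (Expr.bin .eq e f).eval W s ≠ 0 ↔ e.eval W s = f.eval W s := by
  simp only [Expr.eval, Op.eval]
  split_ifs with h <;> simp [h, Nat.mod_eq_of_lt hW]

theorem Expr.eval_lt_ne_zero {s : State} {e f : Expr} (hW : 1 < W) :
    (Expr.bin .lt e f).eval W s ≠ 0 ↔ e.eval W s < f.eval W s := by
  simp only [Expr.eval, Op.eval]
  split_ifs with h <;> simp [h, Nat.mod_eq_of_lt hW]

/-- Branching on the equality of two expressions. -/
theorem Runs.cond_eq {Q : State → ℕ → Prop} {s : State} {e f : Expr} {p q : Prog} (hW : 1 < W)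
    (hp : e.eval W s = f.eval W s → Runs W p (fun s' t => Q s' (e.cost + f.cost + 2 + t)) s)
    (hq : e.eval W s ≠ f.eval W s → Runs W q (fun s' t => Q s' (e.cost + f.cost + 2 + t)) s) :
    Runs W (.cond (.bin .eq e f) p q) Q s :=
  Runs.cond (fun h => hp ((Expr.eval_eq_ne_zero hW).1 h))
    (fun h => hq fun h' => (Expr.eval_eq_ne_zero hW).2 h' h)

/-- Branching on the order of two expressions. -/
theorem Runs.cond_lt {Q : State → ℕ → Prop} {s : State} {e f : Expr} {p q : Prog} (hW : 1 < W)
    (hp : e.eval W s < f.eval W s → Runs W p (fun s' t => Q s' (e.cost + f.cost + 2 + t)) s)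
    (hq : ¬ e.eval W s < f.eval W s → Runs W q (fun s' t => Q s' (e.cost + f.cost + 2 + t)) s) :
    Runs W (.cond (.bin .lt e f) p q) Q s :=
  Runs.cond (fun h => hp ((Expr.eval_lt_ne_zero hW).1 h))
    (fun h => hq fun h' => (Expr.eval_lt_ne_zero hW).2 h' h)

end WordRAM

namespace WordRAM

variable {n k W : ℕ} {M : DNFA 2 (Fin n) (Fin k)} {l : List (Fin n × Fin n × Fin k)} {s : State}

/-! ### Searching the automaton -/

/-- The memory still holds the part of the input that the program reads: the numbers of states and
of edges, the source, and the edges. -/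
structure HoldsInput (M : DNFA 2 (Fin n) (Fin k)) (l : List (Fin n × Fin n × Fin k))
    (s : State) : Prop where
  states : s.reg 0 = n
  edges : s.reg 1 = l.length
  start : s.reg 3 = M.start
  origin : ∀ i (h : i < l.length), s.arr 0 i = (l[i].1 : ℕ)
  target : ∀ i (h : i < l.length), s.arr 1 i = (l[i].2.1 : ℕ)
  label : ∀ i (h : i < l.length), s.arr 2 i = (l[i].2.2 : ℕ)

theorem holdsInput_input (M : DNFA 2 (Fin n) (Fin k)) (l : List (Fin n × Fin n × Fin k)) :
    HoldsInput M l (M.input l) := by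
  constructor <;> simp +contextual [DNFA.input]

@[simp] theorem holdsInput_setReg {x v : ℕ} (h0 : x ≠ 0) (h1 : x ≠ 1) (h3 : x ≠ 3) :
    HoldsInput M l (s.setReg x v) ↔ HoldsInput M l s := by
  constructor <;> rintro ⟨a, b, c, d, e, f⟩ <;> constructor <;>
    first
      | assumption
      | simpa [h0.symm] using a
      | simpa [h1.symm] using b
      | simpa [h3.symm] using c

@[simp] theorem holdsInput_setArr {a i v : ℕ} (h : 2 < a) :
    HoldsInput M l (s.setArr a i v) ↔ HoldsInput M l s := by
  have h0 : 0 ≠ a := by omega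
  have h1 : 1 ≠ a := by omega
  have h2 : 2 ≠ a := by omega
  constructor <;> rintro ⟨a, b, c, d, e, f⟩ <;> constructor <;>
    first
      | assumption
      | simpa [h0] using d
      | simpa [h1] using e
      | simpa [h2] using f

/-- Visit the target of edge number `r₆`: unless this was done before, append it to the queue and
record its parent and its label. -/
def visit : Prog :=
  .cond (.get 7 (.get 1 (.reg 6))) .skip <|
  .seq (.store 4 (.reg 4) (.get 1 (.reg 6))) <|
  .seq (.assign 4 (.bin .add (.reg 4) (.const 1))) <|
  .seq (.store 7 (.get 1 (.reg 6)) (.const 1)) <|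
  .seq (.store 5 (.get 1 (.reg 6)) (.get 0 (.reg 6)))
    (.store 6 (.get 1 (.reg 6)) (.get 2 (.reg 6)))

/-- Search all states from the source.  Array 4 is the queue and register 4 its length; array 7
marks the visited states, arrays 5 and 6 receive their parents and labels. -/
def search : Prog :=
  .seq (.store 4 (.const 0) (.reg 3)) <|
  .seq (.assign 4 (.const 1)) <|
  .seq (.store 7 (.reg 3) (.const 1)) <|
  .forLt 5 0 <| .forLt 6 1 <|
    .cond (.bin .eq (.get 0 (.reg 6)) (.get 4 (.reg 5))) visit .skip

/-- The memory represents the queue `q`, whose members have been visited from the source. -/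
structure HoldsQueue (M : DNFA 2 (Fin n) (Fin k)) (l : List (Fin n × Fin n × Fin k))
    (q : List (Fin n)) (s : State) : Prop where
  input : HoldsInput M l s
  nodup : q.Nodup
  start_mem : M.start ∈ q
  length : s.reg 4 = q.length
  queue : ∀ i (h : i < q.length), s.arr 4 i = (q[i] : ℕ)
  visited : ∀ v : Fin n, s.arr 7 v ≠ 0 ↔ v ∈ q
  parent : ∀ v ∈ q, v ≠ M.start → ∃ p a, (p, v, a) ∈ M.edges ∧ s.arr 5 v = (p : ℕ) ∧
    s.arr 6 v = (a : ℕ) ∧ p ∈ q ∧ q.idxOf p < q.idxOf v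

@[simp] theorem holdsQueue_setReg {q : List (Fin n)} {x v : ℕ} (h : 4 < x) :
    HoldsQueue M l q (s.setReg x v) ↔ HoldsQueue M l q s := by
  have h0 : x ≠ 0 := by omega
  have h1 : x ≠ 1 := by omega
  have h3 : x ≠ 3 := by omega
  have h4 : 4 ≠ x := by omega
  constructor <;> rintro ⟨a, b, c, d, e, f, g⟩ <;> constructor <;>
    first
      | assumption
      | simpa [h0, h1, h3] using a
      | simpa [h4] using d

theorem HoldsQueue.length_le {q : List (Fin n)} (h : HoldsQueue M l q s) : q.length ≤ n := by
  simpa using h.nodup.length_le_card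

/-- If the queue is closed under taking successors then it holds all states. -/
theorem HoldsQueue.mem_of_closed {q : List (Fin n)} (h : HoldsQueue M l q s)
    (hcl : ∀ u ∈ q, ∀ v a, (u, v, a) ∈ M.edges → v ∈ q) (v : Fin n) : v ∈ q := by
  induction M.reachable v with
  | refl => exact h.start_mem
  | tail _ h2 ih =>
    obtain ⟨a, ha⟩ := h2
    exact hcl _ ih _ _ ha

theorem HoldsQueue.length_eq {q : List (Fin n)} (h : HoldsQueue M l q s)
    (hq : ∀ v, v ∈ q) : q.length = n := by
  have h1 : q.toFinset = Finset.univ := by ext v; simp [hq v]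
  have h2 := List.toFinset_card_of_nodup h.nodup
  rw [h1, Finset.card_univ, Fintype.card_fin] at h2
  exact h2.symm

theorem runs_visit (hW : n + 10 < W) {q : List (Fin n)} {j : ℕ} (hj : j < l.length)
    (hl : ∀ e ∈ l, e ∈ M.edges) (hq : HoldsQueue M l q s) (h6 : s.reg 6 = j)
    (hu : l[j].1 ∈ q) :
    Runs W visit (fun s' t => t ≤ 40 ∧ s'.reg 5 = s.reg 5 ∧ s'.reg 6 = j ∧
      ∃ q', q <+: q' ∧ HoldsQueue M l q' s' ∧ l[j].2.1 ∈ q') s := by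
  have ht : (Expr.get 1 (.reg 6)).eval W s = (l[j].2.1 : ℕ) := by
    simp only [Expr.eval, h6, hq.input.target j hj]
  refine Runs.cond (fun h => Runs.skip ?_) (fun h => ?_)
  · refine ⟨by simp [Expr.cost], rfl, h6, q, List.prefix_rfl, hq, ?_⟩
    rw [← hq.visited]
    simpa only [Expr.eval, h6, hq.input.target j hj] using h
  · have hn : l[j].2.1 ∉ q := by
      rw [← hq.visited, not_not]
      simpa only [Expr.eval, h6, hq.input.target j hj] using h
    have hlen := hq.length_le
    have ha : (q.length + 1) % W = q.length + 1 := Nat.mod_eq_of_lt (by omega)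
    have h1 : 1 % W = 1 := Nat.mod_eq_of_lt (by omega)
    refine Runs.seq (Runs.store (Runs.seq (Runs.assign (Runs.seq (Runs.store (Runs.seq
      (Runs.store (Runs.store ?_))))))))
    simp only [Expr.eval, Op.eval, State.setReg_reg, State.setReg_arr, State.setArr_reg,
      State.setArr_arr, h6, hq.length, hq.input.target j hj, Expr.cost, h1, ha]
    simp only [hq.input.target j hj, hq.input.origin j hj, hq.input.label j hj,
      Nat.reduceEqDiff, if_false]
    refine ⟨by omega, by simp, by simp, q ++ [l[j].2.1], by simp, ?_, by simp⟩
    constructor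
    · simpa using hq.input
    · rw [List.nodup_append]
      refine ⟨hq.nodup, by simp, ?_⟩
      rintro a ha b hb rfl
      exact hn (by simpa using (List.mem_singleton.1 hb) ▸ ha)
    · simp [hq.start_mem]
    · simp
    · intro i hi
      simp only [List.length_append, List.length_singleton] at hi
      rcases Nat.lt_or_ge i q.length with h2 | h2
      · simp [List.getElem_append_left h2, h2.ne, hq.queue i h2]
      · obtain rfl : i = q.length := by omega
        simp
    · intro v
      have := hq.visited v
      by_cases hv : v = l[j].2.1
      · subst hv; simp
      · have hv' : (v : ℕ) ≠ l[j].2.1 := fun e => hv (Fin.ext e)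
        simp [hv, hv']
        simpa using this
    · intro v hv hvs
      by_cases he : v = l[j].2.1
      · subst he
        refine ⟨l[j].1, l[j].2.2, hl _ (List.getElem_mem hj), by simp, by simp, by simp [hu], ?_⟩
        rw [List.idxOf_append_of_mem hu, List.idxOf_append_of_notMem hn]
        have := List.idxOf_lt_length_of_mem hu
        omega
      · have hv' : (v : ℕ) ≠ l[j].2.1 := fun e => he (Fin.ext e)
        have hvq : v ∈ q := by simpa [he] using hv
        obtain ⟨p, a, h1, h2, h3, h4, h5⟩ := hq.parent v hvq hvs
        refine ⟨p, a, h1, ?_, ?_, by simp [h4], ?_⟩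
        · simp [hv', h2]
        · simp [hv', h3]
        · rw [List.idxOf_append_of_mem h4, List.idxOf_append_of_mem hvq]
          exact h5

/-- The result of the search: a spanning tree, in arrays 5 and 6, and in array 4 the list of the
states by their positions. -/
structure HoldsTree (M : DNFA 2 (Fin n) (Fin k)) (l : List (Fin n × Fin n × Fin k))
    (par : Fin n → Fin n) (lb : Fin n → ℕ) (pos : Fin n → ℕ) (s : State) : Prop where
  input : HoldsInput M l s
  parent : ∀ v, v ≠ M.start → s.arr 5 v = (par v : ℕ)
  label : ∀ v, v ≠ M.start → s.arr 6 v = lb v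
  pos_lt : ∀ v, pos v < n
  state : ∀ i < n, ∃ u : Fin n, s.arr 4 i = u ∧ pos u = i ∧ ∀ w, pos w = i → w = u

theorem runs_search (hW : n + l.length + 10 < W) (hl : ∀ e, e ∈ l ↔ e ∈ M.edges)
    (hs : HoldsInput M l s) (h7 : ∀ v, s.arr 7 v = 0) :
    Runs W search (fun s' t => t ≤ n * (l.length * 60 + 20) + 30 ∧
      ∃ par lb pos, IsSpanningTree M par lb pos ∧ HoldsTree M l par lb pos s') s := by
  have hW1 : 1 < W := by omega
  have h1W : 1 % W = 1 := Nat.mod_eq_of_lt hW1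
  have hn : 0 < n := M.start.pos
  refine Runs.seq (Runs.store (Runs.seq (Runs.assign (Runs.seq (Runs.store ?_)))))
  refine Runs.forLt_le (N := n) (by omega) hW1 (l.length * 60 + 6)
    (fun i s => ∃ q, HoldsQueue M l q s ∧ ∀ u ∈ q.take i, ∀ v a, (u, v, a) ∈ M.edges → v ∈ q)
    ?_ ?_ ?_ ?_
  · rintro i s ⟨q, hq, -⟩
    exact hq.input.states
  · refine ⟨[M.start], ?_, by simp⟩
    simp only [Expr.eval, Nat.zero_mod, h1W, State.setReg_reg, State.setArr_reg]
    constructor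
    · simpa using hs
    · simp
    · simp
    · simp
    · intro i hi
      obtain rfl : i = 0 := by simpa using hi
      simp [hs.start]
    · intro v
      simp [hs.start, Function.update_apply, h7, Fin.ext_iff]
    · intro v hv hvs
      exact absurd (by simpa using hv) hvs
  · rintro i hi s ⟨q, hq, hcl⟩ h5
    have hiq : i < q.length := by
      by_contra! hge
      have := hq.length_eq (hq.mem_of_closed (by rwa [List.take_of_length_le hge] at hcl))
      omega
    refine Runs.forLt_le (N := l.length) (by omega) hW1 52
      (fun j s => s.reg 5 = i ∧ ∃ q', q <+: q' ∧ HoldsQueue M l q' s ∧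
        ∀ j' < j, ∀ h : j' < l.length, l[j'].1 = q[i] → l[j'].2.1 ∈ q') ?_ ?_ ?_ ?_
    · rintro i s ⟨-, q', -, hq', -⟩
      exact hq'.input.edges
    · exact ⟨by simpa using h5, q, List.prefix_rfl, by simpa using hq, by simp⟩
    · rintro j hj s ⟨h5, q', hpre, hq', hcl'⟩ h6
      have hiq' : i < q'.length := lt_of_lt_of_le hiq hpre.length_le
      have hget : q'[i] = q[i] := (hpre.getElem hiq).symm
      have ev1 : (Expr.get 0 (.reg 6)).eval W s = (l[j].1 : ℕ) := by
        simp only [Expr.eval, h6, hq'.input.origin j hj]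
      have ev2 : (Expr.get 4 (.reg 5)).eval W s = (q[i] : ℕ) := by
        simp only [Expr.eval, h5, hq'.queue i hiq', hget]
      refine Runs.cond_eq hW1 (fun h => ?_) (fun h => Runs.skip ?_)
      · rw [ev1, ev2, ← Fin.ext_iff] at h
        have hu : l[j].1 ∈ q' := by rw [h, ← hget]; exact List.getElem_mem _
        refine (runs_visit (by omega) hj (fun e he => (hl e).1 he) hq' h6 hu).mono ?_
        rintro s' t ⟨ht, h5', h6', q'', hpre', hq'', hmem⟩
        refine ⟨by simp [Expr.cost]; omega, h6', by simp [h5', h5], q'', hpre.trans hpre',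
          by simpa using hq'', ?_⟩
        intro j' hj' hlt he
        rcases Nat.lt_succ_iff_lt_or_eq.1 hj' with h | rfl
        · exact hpre'.subset (hcl' j' h hlt he)
        · exact hmem
      · rw [ev1, ev2, Ne, ← Fin.ext_iff] at h
        refine ⟨by simp [Expr.cost], h6, by simp [h5], q', hpre, by simpa using hq', ?_⟩
        intro j' hj' hlt he
        rcases Nat.lt_succ_iff_lt_or_eq.1 hj' with h' | rfl
        · exact hcl' j' h' hlt he
        · exact absurd he h
    · rintro s t ht ⟨h5, q', hpre, hq', hcl'⟩
      refine ⟨by omega, h5, q', by simpa using hq', ?_⟩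
      intro u hu v a he
      obtain ⟨r, rfl⟩ := hpre
      rw [List.take_append_of_le_length (by omega), List.take_succ_eq_append_getElem hiq,
        List.mem_append, List.mem_singleton] at hu
      rcases hu with hu | rfl
      · exact List.mem_append_left _ (hcl u hu v a he)
      · obtain ⟨j, hj, e⟩ := List.mem_iff_getElem.1 ((hl _).2 he)
        have := hcl' j hj hj (by rw [e])
        rwa [e] at this
  · rintro s t ht ⟨q, hq, hcl⟩
    have hmem := hq.mem_of_closed (by rwa [List.take_of_length_le hq.length_le] at hcl)
    have hlen := hq.length_eq hmem
    refine ⟨?_, ?_⟩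
    · simp only [Expr.cost]
      have : n * (l.length * 60 + 6 + 8) ≤ n * (l.length * 60 + 20) :=
        Nat.mul_le_mul_left _ (by omega)
      omega
    · choose par lb h1 h2 h3 h4 h5 using fun v : Fin n => fun hv => hq.parent v (hmem v) hv
      -- the parent and the label of the source are of no significance
      refine ⟨fun v => if hv : v = M.start then v else par v hv,
        fun v => if hv : v = M.start then 0 else lb v hv, fun v => q.idxOf v, ⟨?_, ?_⟩, ?_⟩
      · intro v hv
        exact ⟨lb v hv, by simp [hv], by simpa [hv] using h1 v hv⟩
      · intro v hv
        simpa [hv] using h5 v hv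
      · constructor
        · simpa using hq.input
        · intro v hv
          simpa [hv] using h2 v hv
        · intro v hv
          simpa [hv] using h3 v hv
        · intro v
          exact (List.idxOf_lt_length_of_mem (hmem v)).trans_eq hlen
        · intro i hi
          have hi' : i < q.length := by omega
          refine ⟨q[i], hq.queue i hi', hq.nodup.idxOf_getElem i hi', ?_⟩
          rintro w rfl
          simp

end WordRAM

namespace WordRAM

variable {n k W : ℕ} {M : DNFA 2 (Fin n) (Fin k)} {l : List (Fin n × Fin n × Fin k)} {s : State}
  {par : Fin n → Fin n} {lb pos : Fin n → ℕ}

/-! ### Tabulating the literals -/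

/-- The address of the entry for row `e` and column `f` in a table with `r₀` columns. -/
def Expr.entry (e f : Expr) : Expr := .bin .add (.bin .mul e (.reg 0)) f

/-- The table of the numbers `T u v` which array 8 holds. -/
def State.table (s : State) (u v : Fin n) : ℕ := s.arr 8 (u * n + v)

theorem entry_lt (u v : Fin n) : (u * n + v : ℕ) < n * n := by
  have h1 : ((u : ℕ) + 1) * n ≤ n * n := Nat.mul_le_mul_right _ u.2
  have h2 := v.2
  rw [add_mul] at h1
  omega

theorem entry_inj {u v u' v' : Fin n} : (u * n + v : ℕ) = u' * n + v' ↔ u = u' ∧ v = v' := by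
  refine ⟨fun h => ?_, fun h => by rw [h.1, h.2]⟩
  have hn := u.pos
  have h1 := congrArg (· / n) h
  have h2 := congrArg (· % n) h
  simp only [Nat.mul_add_mod, Nat.mod_eq_of_lt v.2, Nat.mod_eq_of_lt v'.2, mul_comm _ n,
    Nat.mul_add_div hn, Nat.div_eq_of_lt v.2, Nat.div_eq_of_lt v'.2, add_zero] at h1 h2
  exact ⟨Fin.ext h1, Fin.ext h2⟩

theorem Expr.eval_entry (hW : n * n < W) (h0 : s.reg 0 = n) {e f : Expr} {u v : Fin n}
    (he : e.eval W s = u) (hf : f.eval W s = v) : (entry e f).eval W s = u * n + v := by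
  have h := entry_lt u v
  simp only [entry, Expr.eval, Op.eval, he, hf, h0]
  rw [Nat.mod_eq_of_lt (a := u * n) (by omega), Nat.mod_eq_of_lt (by omega)]

@[simp] theorem State.table_setReg (x c : ℕ) :
    ((s.setReg x c).table : Fin n → Fin n → ℕ) = s.table := rfl

theorem State.table_setArr {c : ℕ} (u v u' v' : Fin n) :
    (s.setArr 8 (u * n + v) c).table u' v' = if u' = u ∧ v' = v then c else s.table u' v' := by
  simp [State.table, Function.update_apply, entry_inj]

@[simp] theorem holdsTree_setReg {x c : ℕ} (h : 3 < x) :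
    HoldsTree M l par lb pos (s.setReg x c) ↔ HoldsTree M l par lb pos s := by
  have h0 : x ≠ 0 := by omega
  have h1 : x ≠ 1 := by omega
  have h3 : x ≠ 3 := by omega
  constructor <;> rintro ⟨a, b, c, d, e⟩ <;> constructor <;>
    first
      | assumption
      | simpa [h0, h1, h3] using a

@[simp] theorem holdsTree_setArr {a i c : ℕ} (h : 6 < a) :
    HoldsTree M l par lb pos (s.setArr a i c) ↔ HoldsTree M l par lb pos s := by
  have h2 : 2 < a := by omega
  have h4 : 4 ≠ a := by omega
  have h5 : 5 ≠ a := by omega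
  have h6 : 6 ≠ a := by omega
  constructor <;> rintro ⟨a, b, c, d, e⟩ <;> constructor <;>
    first
      | assumption
      | simpa [h2] using a
      | simpa [h5] using b
      | simpa [h6] using c
      | simpa [h4] using e

/-- Compute the literal of the states `r₇` and `r₆` in register 8. -/
def literal : Prog :=
  .cond (.bin .eq (.reg 7) (.reg 6)) (.assign 8 (.const 0)) <|
  .cond (.bin .eq (.reg 7) (.reg 3)) (.assign 8 (.const 1)) <|
  .cond (.bin .eq (.reg 6) (.reg 3)) (.assign 8 (.const 0)) <|
  .cond (.bin .lt (.get 6 (.reg 7)) (.get 6 (.reg 6))) (.assign 8 (.const 1)) <|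
  .cond (.bin .lt (.get 6 (.reg 6)) (.get 6 (.reg 7))) (.assign 8 (.const 0)) <|
  .cond (.bin .eq (.get 5 (.reg 7)) (.get 5 (.reg 6)))
    (.cond (.bin .lt (.reg 7) (.reg 6))
      (.assign 8 (.bin .add (.bin .add (.reg 7) (.reg 7)) (.const 2)))
      (.assign 8 (.bin .add (.bin .add (.reg 6) (.reg 6)) (.const 3))))
    (.assign 8 (.get 8 (.entry (.get 5 (.reg 7)) (.get 5 (.reg 6)))))

theorem runs_literal (hW : n * n + 2 * n + 10 < W) (hs : HoldsTree M l par lb pos s)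
    {u v : Fin n} (h7 : s.reg 7 = u) (h6 : s.reg 6 = v) :
    Runs W literal
      (fun s' t => t ≤ 60 ∧ s' = s.setReg 8 (pairLit M.start par lb s.table u v)) s := by
  have hW1 : 1 < W := by omega
  have hu := u.2
  have hv := v.2
  have e7 : (Expr.reg 7).eval W s = u := h7
  have e6 : (Expr.reg 6).eval W s = v := h6
  have e3 : (Expr.reg 3).eval W s = M.start := hs.input.start
  have c0 : (Expr.const 0).eval W s = 0 := Expr.eval_const (by omega)
  have c1 : (Expr.const 1).eval W s = 1 := Expr.eval_const (by omega)
  have d7 : (Expr.bin .add (.bin .add (.reg 7) (.reg 7)) (.const 2)).eval W s = 2 * u + 2 := by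
    simp only [Expr.eval, Op.eval, h7]
    rw [Nat.mod_eq_of_lt (a := u + u) (by omega), Nat.mod_eq_of_lt (a := 2) (by omega),
      Nat.mod_eq_of_lt (by omega)]
    omega
  have d6 : (Expr.bin .add (.bin .add (.reg 6) (.reg 6)) (.const 3)).eval W s = 2 * v + 3 := by
    simp only [Expr.eval, Op.eval, h6]
    rw [Nat.mod_eq_of_lt (a := v + v) (by omega), Nat.mod_eq_of_lt (a := 3) (by omega),
      Nat.mod_eq_of_lt (by omega)]
    omega
  unfold literal pairLit
  refine Runs.cond_eq hW1 (fun h1 => ?_) (fun h1 => ?_)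
  · rw [e7, e6, ← Fin.ext_iff] at h1
    refine Runs.assign ⟨by simp [Expr.cost], ?_⟩
    rw [if_pos h1, c0]
  rw [e7, e6, Ne, ← Fin.ext_iff] at h1
  rw [if_neg h1]
  refine Runs.cond_eq hW1 (fun h2 => ?_) (fun h2 => ?_)
  · rw [e7, e3, ← Fin.ext_iff] at h2
    refine Runs.assign ⟨by simp [Expr.cost], ?_⟩
    rw [if_pos h2, c1]
  rw [e7, e3, Ne, ← Fin.ext_iff] at h2
  rw [if_neg h2]
  refine Runs.cond_eq hW1 (fun h3 => ?_) (fun h3 => ?_)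
  · rw [e6, e3, ← Fin.ext_iff] at h3
    refine Runs.assign ⟨by simp [Expr.cost], ?_⟩
    rw [if_pos h3, c0]
  rw [e6, e3, Ne, ← Fin.ext_iff] at h3
  rw [if_neg h3]
  have l7 : (Expr.get 6 (.reg 7)).eval W s = lb u := by
    simp only [Expr.eval, h7, hs.label u h2]
  have l6 : (Expr.get 6 (.reg 6)).eval W s = lb v := by
    simp only [Expr.eval, h6, hs.label v h3]
  have p7 : (Expr.get 5 (.reg 7)).eval W s = par u := by
    simp only [Expr.eval, h7, hs.parent u h2]
  have p6 : (Expr.get 5 (.reg 6)).eval W s = par v := by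
    simp only [Expr.eval, h6, hs.parent v h3]
  refine Runs.cond_lt hW1 (fun h4 => ?_) (fun h4 => ?_)
  · rw [l7, l6] at h4
    refine Runs.assign ⟨by simp [Expr.cost], ?_⟩
    rw [if_pos h4, c1]
  rw [l7, l6] at h4
  rw [if_neg h4]
  refine Runs.cond_lt hW1 (fun h5 => ?_) (fun h5 => ?_)
  · rw [l7, l6] at h5
    refine Runs.assign ⟨by simp [Expr.cost], ?_⟩
    rw [if_pos h5, c0]
  rw [l7, l6] at h5
  rw [if_neg h5]
  refine Runs.cond_eq hW1 (fun hp => ?_) (fun hp => ?_)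
  · rw [p7, p6, ← Fin.ext_iff] at hp
    rw [if_pos hp]
    refine Runs.cond_lt hW1 (fun hlt => ?_) (fun hlt => ?_)
    · rw [e7, e6, ← Fin.lt_def] at hlt
      refine Runs.assign ⟨by simp [Expr.cost], ?_⟩
      rw [if_pos hlt, d7]
    · rw [e7, e6, ← Fin.lt_def] at hlt
      refine Runs.assign ⟨by simp [Expr.cost], ?_⟩
      rw [if_neg hlt, d6]
  · rw [p7, p6, Ne, ← Fin.ext_iff] at hp
    refine Runs.assign ⟨by simp [Expr.cost, Expr.entry], ?_⟩
    rw [if_neg hp, Expr.eval, Expr.eval_entry (by omega) hs.input.states p7 p6]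
    rfl

/-- Compute the literals of all pairs of states, row by row in the order of the queue. -/
def tabulate : Prog :=
  .forLt 5 0 <| .seq (.assign 7 (.get 4 (.reg 5))) <|
    .forLt 6 0 <| .seq literal (.store 8 (.entry (.reg 7) (.reg 6)) (.reg 8))

theorem runs_tabulate (hW : n * n + 2 * n + 10 < W) (hT : IsSpanningTree M par lb pos)
    (hs : HoldsTree M l par lb pos s) :
    Runs W tabulate (fun s' t => t ≤ n * (n * 80 + 20) + 6 ∧ HoldsInput M l s' ∧
      ∀ u v, s'.table u v = pairLit M.start par lb s'.table u v) s := by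
  have hW1 : 1 < W := by omega
  refine Runs.forLt_le (N := n) (by omega) hW1 (n * 80 + 12)
    (fun i s => HoldsTree M l par lb pos s ∧
      ∀ u, pos u < i → ∀ v, s.table u v = pairLit M.start par lb s.table u v) ?_ ?_ ?_ ?_
  · rintro i s ⟨h, -⟩
    exact h.input.states
  · exact ⟨by simpa using hs, by simp⟩
  · rintro i hi s ⟨hs, hrow⟩ h5
    obtain ⟨u, hu, rfl, huniq⟩ := hs.state i hi
    refine Runs.seq (Runs.assign ?_)
    have e : (Expr.get 4 (.reg 5)).eval W s = u := by simp only [Expr.eval, h5, hu]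
    rw [e]
    refine Runs.forLt_le (N := n) (by omega) hW1 72
      (fun j s => HoldsTree M l par lb pos s ∧ s.reg 5 = pos u ∧ s.reg 7 = u ∧
        (∀ w, pos w < pos u → ∀ v, s.table w v = pairLit M.start par lb s.table w v) ∧
        ∀ v : Fin n, v < j → s.table u v = pairLit M.start par lb s.table u v) ?_ ?_ ?_ ?_
    · rintro i s ⟨h, -⟩
      exact h.input.states
    · exact ⟨by simpa using hs, by simpa using h5, by simp, hrow, by simp⟩
    · rintro j hj s ⟨hs, h5, h7, hrow, hcol⟩ h6
      lift j to Fin n using hj with v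
      refine Runs.seq ((runs_literal hW hs h7 h6).mono ?_)
      rintro s' t ⟨ht, rfl⟩
      refine Runs.store ?_
      rw [Expr.eval_entry (u := u) (v := v) (by omega) (by simpa using hs.input.states)
        (by simpa [Expr.eval] using h7) (by simpa [Expr.eval] using h6)]
      simp only [Expr.eval, State.setReg_reg, if_true]
      -- a row depends on earlier rows only
      have hsame : ∀ w, pos w ≤ pos u → ∀ x, pairLit M.start par lb
          (((s.setReg 8 (pairLit M.start par lb s.table u v)).setArr 8 (u * n + v)
            (pairLit M.start par lb s.table u v)).setReg 6 (v + 1)).table w x =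
          pairLit M.start par lb s.table w x := by
        intro w hw x
        refine pairLit_congr fun h1 => ?_
        rw [State.table_setReg, State.table_setArr, if_neg, State.table_setReg]
        rintro ⟨h2, -⟩
        have := hT.pos_lt w h1
        rw [h2] at this
        omega
      refine ⟨by simp [Expr.cost, Expr.entry]; omega, by simp [h6], by simpa using hs,
        by simpa using h5, by simpa using h7, ?_, ?_⟩
      · intro w hw x
        rw [hsame w hw.le, ← hrow w hw x, State.table_setReg, State.table_setArr, if_neg,
          State.table_setReg]
        rintro ⟨rfl, -⟩
        omega
      · intro x hx
        rw [hsame u le_rfl, State.table_setReg, State.table_setArr, State.table_setReg]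
        split_ifs with h
        · rw [h.2]
        · refine hcol x ?_
          have : (x : ℕ) ≠ v := fun e => h ⟨rfl, Fin.ext e⟩
          omega
    · rintro s t ht ⟨hs, h5, h7, hrow, hcol⟩
      refine ⟨by simp [Expr.cost]; omega, h5, by simpa using hs, ?_⟩
      intro w hw v
      rcases Nat.lt_succ_iff_lt_or_eq.1 hw with h | h
      · exact hrow w h v
      · rw [huniq w h]
        exact hcol v v.2
  · rintro s t ht ⟨hs, hrow⟩
    have : n * (n * 80 + 12 + 8) = n * (n * 80 + 20) := by ring
    exact ⟨by omega, hs.input, fun u v => hrow u (hs.pos_lt u) v⟩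

end WordRAM

namespace WordRAM

variable {n k W : ℕ} {M : DNFA 2 (Fin n) (Fin k)} {l : List (Fin n × Fin n × Fin k)}
  {s s' : State} {T : Fin n → Fin n → ℕ}

/-! ### Solving the constraints of the linked edges -/

/-- Follow the substitution in array 9 by replacing the literals `r_a`, `r_a'` by `r_b`, `r_b'`. -/
def substitute (a a' b b' : ℕ) : Prog :=
  .forLt 12 4 <|
    .cond (.bin .eq (.get 9 (.reg 12)) (.reg a)) (.store 9 (.reg 12) (.reg b)) <|
    .cond (.bin .eq (.get 9 (.reg 12)) (.reg a')) (.store 9 (.reg 12) (.reg b')) .skip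

theorem runs_substitute {a a' b b' N : ℕ} (hW : N + 1 < W) (h4 : s.reg 4 = N) (ha : a ≠ 12)
    (ha' : a' ≠ 12) (hb : b ≠ 12) (hb' : b' ≠ 12) :
    Runs W (substitute a a' b b') (fun s' t => t ≤ N * 30 + 6 ∧ (∀ y ≠ 12, s'.reg y = s.reg y) ∧
      (∀ c ≠ 9, s'.arr c = s.arr c) ∧ ∀ x < N, s'.arr 9 x =
        mergeLit (s.arr 9) (s.reg a) (s.reg a') (s.reg b) (s.reg b') x) s := by
  have hW1 : 1 < W := by omega
  refine Runs.forLt_le (N := N) (by omega) hW1 22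
    (fun i s' => (∀ y ≠ 12, s'.reg y = s.reg y) ∧ (∀ c ≠ 9, s'.arr c = s.arr c) ∧
      (∀ x < i, s'.arr 9 x =
        mergeLit (s.arr 9) (s.reg a) (s.reg a') (s.reg b) (s.reg b') x) ∧
      ∀ x, i ≤ x → s'.arr 9 x = s.arr 9 x) ?_ ?_ ?_ ?_
  · rintro i s' ⟨h, -⟩
    rw [h 4 (by omega), h4]
  · exact ⟨fun y hy => by simp [hy], by simp, by simp, by simp⟩
  · rintro i hi s' ⟨hr, hc, hlt, hge⟩ h12
    have e : (Expr.get 9 (.reg 12)).eval W s' = s.arr 9 i := by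
      simp only [Expr.eval, h12, hge i le_rfl]
    have ea : (Expr.reg a).eval W s' = s.reg a := hr a ha
    have ea' : (Expr.reg a').eval W s' = s.reg a' := hr a' ha'
    have eb : (Expr.reg b).eval W s' = s.reg b := hr b hb
    have eb' : (Expr.reg b').eval W s' = s.reg b' := hr b' hb'
    have e12 : (Expr.reg 12).eval W s' = i := h12
    have hupd : ∀ v, v = mergeLit (s.arr 9) (s.reg a) (s.reg a') (s.reg b) (s.reg b') i →
        ((∀ y ≠ 12, ((s'.setArr 9 i v).setReg 12 (i + 1)).reg y = s.reg y) ∧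
        (∀ c ≠ 9, ((s'.setArr 9 i v).setReg 12 (i + 1)).arr c = s.arr c) ∧
        (∀ x < i + 1, ((s'.setArr 9 i v).setReg 12 (i + 1)).arr 9 x =
          mergeLit (s.arr 9) (s.reg a) (s.reg a') (s.reg b) (s.reg b') x) ∧
        ∀ x, i + 1 ≤ x → ((s'.setArr 9 i v).setReg 12 (i + 1)).arr 9 x = s.arr 9 x) := by
      intro v hv
      refine ⟨fun y hy => by simp [hy, hr y hy], fun c h => by simp [h, hc c h], ?_, ?_⟩
      · intro x hx
        by_cases hxi : x = i
        · simp [hxi, hv]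
        · simp [hxi, hlt x (by omega)]
      · intro x hx
        have hxi : x ≠ i := by omega
        simp [hxi, hge x (by omega)]
    refine Runs.cond_eq hW1 (fun h1 => Runs.store ?_)
      (fun h1 => Runs.cond_eq hW1 (fun h2 => Runs.store ?_) (fun h2 => Runs.skip ?_))
    · rw [e, ea] at h1
      rw [e12, eb]
      exact ⟨by simp [Expr.cost], h12, hupd _ (by simp [mergeLit, h1])⟩
    · rw [e, ea] at h1
      rw [e, ea'] at h2
      rw [e12, eb']
      exact ⟨by simp [Expr.cost], h12, hupd _ (by rw [mergeLit, if_neg h1, if_pos h2])⟩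
    · rw [e, ea] at h1
      rw [e, ea'] at h2
      refine ⟨by simp [Expr.cost], h12, fun y hy => by simp [hy, hr y hy],
        fun c h => by simp [hc c h], ?_, ?_⟩
      · intro x hx
        by_cases hxi : x = i
        · subst hxi
          simp [mergeLit, h1, h2, hge x le_rfl]
        · simpa using hlt x (by omega)
      · intro x hx
        simpa using hge x (by omega)
  · rintro s' t ht ⟨hr, hc, hlt, -⟩
    exact ⟨by omega, hr, hc, hlt⟩

/-- The automaton has consistent labels and the truth assignment `ρ` satisfies the constraints of
all linked edges.  Every Wheeler order gives such an assignment. -/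
structure IsModel (M : DNFA 2 (Fin n) (Fin k)) (T : Fin n → Fin n → ℕ) (ρ : ℕ → Prop) : Prop where
  assignment : IsAssignment ρ
  consistent : IsInputConsistent M.edges
  linked : ∀ e ∈ M.edges, ∀ f ∈ M.edges, AreLinked e f → (ρ (T e.1 f.1) ↔ ρ (T e.2.1 f.2.1))

/-- The constraints imposed by a pair of edges on the automaton and on the substitution `σ`. -/
def Satisfies (T : Fin n → Fin n → ℕ) (σ : ℕ → ℕ) (e f : Fin n × Fin n × Fin k) : Prop :=
  (e.2.1 = f.2.1 → e.2.2 = f.2.2) ∧ (AreLinked e f → σ (T e.1 f.1) = σ (T e.2.1 f.2.1))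

/-- The memory while the constraints are being solved: array 9 holds a substitution, register 7 is
nonzero if a contradiction was found, and `D` tells which pairs of edges have been treated. -/
structure Solving (M : DNFA 2 (Fin n) (Fin k)) (l : List (Fin n × Fin n × Fin k))
    (T : Fin n → Fin n → ℕ) (D : Fin n × Fin n × Fin k → Fin n × Fin n × Fin k → Prop)
    (s : State) : Prop where
  input : HoldsInput M l s
  size : s.reg 4 = 2 * n + 2
  table : s.table = T
  subst : IsSubst n (s.arr 9)
  sound : s.reg 7 = 0 → ∀ e f, D e f → Satisfies T (s.arr 9) e f
  complete : ∀ ρ, IsModel M T ρ → s.reg 7 = 0 ∧ ∀ c < 2 * n + 2, (ρ (s.arr 9 c) ↔ ρ c)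

/-- The number of values of the substitution in array 9.  Every merge lowers it, which pays for the
time linear in `n` that a merge takes. -/
def potential (n : ℕ) (s : State) : ℕ := ((Finset.range (2 * n + 2)).image (s.arr 9)).card

theorem potential_le (n : ℕ) (s : State) : potential n s ≤ 2 * n + 2 :=
  Finset.card_image_le.trans_eq (Finset.card_range _)

variable {D : Fin n × Fin n × Fin k → Fin n × Fin n × Fin k → Prop}

@[simp] theorem potential_setReg (x c : ℕ) : potential n (s.setReg x c) = potential n s := rfl

theorem HoldsInput.congr (h : HoldsInput M l s) (hr : ∀ y < 4, s'.reg y = s.reg y)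
    (ha : ∀ c < 3, s'.arr c = s.arr c) : HoldsInput M l s' where
  states := by rw [hr 0 (by omega), h.states]
  edges := by rw [hr 1 (by omega), h.edges]
  start := by rw [hr 3 (by omega), h.start]
  origin := by rw [ha 0 (by omega)]; exact h.origin
  target := by rw [ha 1 (by omega)]; exact h.target
  label := by rw [ha 2 (by omega)]; exact h.label

theorem Solving.setReg (h : Solving M l T D s) {x c : ℕ} (h4 : 4 < x) (h7 : x ≠ 7) :
    Solving M l T D (s.setReg x c) where
  input := h.input.congr (fun y hy => by simp [show y ≠ x by omega]) (by simp)
  size := by simp [show 4 ≠ x by omega, h.size]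
  table := h.table
  subst := h.subst
  sound h0 := h.sound (by simpa [h7.symm] using h0)
  complete ρ hρ := by simpa [h7.symm] using h.complete ρ hρ

theorem Solving.congr_done {D' : Fin n × Fin n × Fin k → Fin n × Fin n × Fin k → Prop}
    (h : Solving M l T D s) (hD : ∀ e f, D' e f → D e f) : Solving M l T D' s :=
  { h with sound := fun h0 e f hef => h.sound h0 e f (hD e f hef) }

theorem Solving.add_done (h : Solving M l T D s) {e f : Fin n × Fin n × Fin k}
    (hef : s.reg 7 = 0 → Satisfies T (s.arr 9) e f) :
    Solving M l T (fun e' f' => D e' f' ∨ e' = e ∧ f' = f) s :=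
  { h with
    sound := by
      rintro h0 e' f' (h1 | ⟨rfl, rfl⟩)
      · exact h.sound h0 _ _ h1
      · exact hef h0 }

theorem Solving.fail (h : Solving M l T D s) (hno : ∀ ρ, ¬ IsModel M T ρ) :
    Solving M l T D (s.setReg 7 1) where
  input := h.input.congr (fun y hy => by simp [show y ≠ 7 by omega]) (by simp)
  size := by simp [h.size]
  table := h.table
  subst := h.subst
  sound h0 := by simp at h0
  complete ρ hρ := absurd hρ (hno ρ)

/-- A merge of two different, not complementary literals which agree in all models. -/
theorem Solving.merge (h : Solving M l T D s) {x y : ℕ} (hx : x < 2 * n + 2)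
    (hy : y < 2 * n + 2) (h2 : 2 ≤ s.arr 9 x) (hne : s.arr 9 y ≠ s.arr 9 x)
    (hneg : s.arr 9 y ≠ negLit (s.arr 9 x)) (hxy : ∀ ρ, IsModel M T ρ → (ρ x ↔ ρ y))
    (hr : ∀ z ≠ 12, s'.reg z = s.reg z) (ha : ∀ c ≠ 9, s'.arr c = s.arr c)
    (h9 : ∀ z < 2 * n + 2, s'.arr 9 z = mergeLit (s.arr 9) (s.arr 9 x) (negLit (s.arr 9 x))
      (s.arr 9 y) (negLit (s.arr 9 y)) z) (hTlt : ∀ u v, T u v < 2 * n + 2) :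
    Solving M l T D s' ∧ s'.arr 9 x = s'.arr 9 y ∧ potential n s' < potential n s := by
  refine ⟨⟨?_, ?_, ?_, ?_, ?_, ?_⟩, ?_, ?_⟩
  · exact h.input.congr (fun z hz => hr z (by omega)) (fun c hc => ha c (by omega))
  · rw [hr 4 (by omega), h.size]
  · rw [← h.table]
    funext u v
    simp only [State.table, ha 8 (by omega)]
  · exact h.subst.merge h9 h2 (h.subst.lt y hy)
  · rw [hr 7 (by omega)]
    intro h0 e f hef
    refine ⟨(h.sound h0 e f hef).1, fun hl => ?_⟩
    rw [h9 _ (hTlt _ _), h9 _ (hTlt _ _)]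
    exact mergeLit_congr ((h.sound h0 e f hef).2 hl)
  · intro ρ hρ
    obtain ⟨h7, hσ⟩ := h.complete ρ hρ
    refine ⟨by rw [hr 7 (by omega), h7], fun c hc => ?_⟩
    rw [h9 c hc]
    refine hρ.assignment.mergeLit_iff ?_ (hσ c hc)
    rw [hσ x hx, hσ y hy]
    exact hxy ρ hρ
  · rw [h9 x hx, h9 y hy]
    exact mergeLit_eq rfl rfl hne hneg
  · exact h.subst.card_image_merge_lt h9 hx hy rfl rfl hne hneg

/-- The literal, under the substitution in array 9, of the pair of the states in the cells number
`r_x` and `r_y` of array `a`. -/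
def Expr.current (a x y : ℕ) : Expr := .get 9 (.get 8 (.entry (.get a (.reg x)) (.get a (.reg y))))

/-- Identify the literals of the origins and of the targets of the edges number `r₅` and `r₆`. -/
def unify : Prog :=
  .seq (.assign 8 (.current 0 5 6)) <|
  .seq (.assign 9 (.current 0 6 5)) <|
  .seq (.assign 10 (.current 1 5 6)) <|
  .seq (.assign 11 (.current 1 6 5)) <|
  .cond (.bin .eq (.reg 8) (.reg 10)) .skip <|
  .cond (.bin .eq (.reg 8) (.reg 11)) (.assign 7 (.const 1)) <|
  .cond (.bin .lt (.reg 8) (.const 2)) (substitute 10 11 8 9) (substitute 8 9 10 11)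

theorem runs_unify (hW : n * n + 2 * n + 10 < W) (hl : ∀ e ∈ l, e ∈ M.edges)
    (hTlt : ∀ u v, T u v < 2 * n + 2) (hTneg : ∀ u v, u ≠ v → T v u = negLit (T u v))
    {i j : ℕ} (hi : i < l.length) (hj : j < l.length) (hs : Solving M l T D s)
    (h5 : s.reg 5 = i) (h6 : s.reg 6 = j) (hij : AreLinked l[i] l[j]) :
    Runs W unify (fun s' t => t + potential n s' * (n * 60 + 66) ≤
        potential n s * (n * 60 + 66) + 90 ∧ s'.reg 5 = i ∧ s'.reg 6 = j ∧
      Solving M l T (fun e f => D e f ∨ e = l[i] ∧ f = l[j]) s') s := by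
  have hW1 : 1 < W := by omega
  obtain ⟨hlab, horg, htgt⟩ := id hij
  set x := T l[i].1 l[j].1 with hxdef
  set y := T l[i].2.1 l[j].2.1 with hydef
  have hx : x < 2 * n + 2 := hTlt _ _
  have hy : y < 2 * n + 2 := hTlt _ _
  have hx' : s.arr 9 (T l[j].1 l[i].1) = negLit (s.arr 9 x) := by
    rw [hTneg _ _ horg, hs.subst.neg _ hx]
  have hy' : s.arr 9 (T l[j].2.1 l[i].2.1) = negLit (s.arr 9 y) := by
    rw [hTneg _ _ htgt, hs.subst.neg _ hy]
  have hTs : ∀ u v : Fin n, s.arr 8 (u * n + v) = T u v := fun u v => by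
    rw [← hs.table]; rfl
  have hcur : ∀ (s' : State) (a p q : ℕ) (u v : Fin n), s'.arr = s.arr → s'.reg 0 = n →
      s.arr a (s'.reg p) = u → s.arr a (s'.reg q) = v →
      (Expr.current a p q).eval W s' = s.arr 9 (T u v) := by
    intro s' a p q u v harr h0 hp hq
    rw [Expr.current, Expr.eval, Expr.eval,
      Expr.eval_entry (u := u) (v := v) (by omega) h0 (by simp only [Expr.eval, harr, hp])
        (by simp only [Expr.eval, harr, hq]), harr, hTs]
  have hxy : ∀ ρ, IsModel M T ρ → (ρ x ↔ ρ y) := fun ρ hρ =>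
    hρ.linked _ (hl _ (List.getElem_mem hi)) _ (hl _ (List.getElem_mem hj)) hij
  refine Runs.seq (Runs.assign (Runs.seq (Runs.assign (Runs.seq (Runs.assign
    (Runs.seq (Runs.assign ?_)))))))
  rw [hcur s 0 5 6 l[i].1 l[j].1 rfl hs.input.states (by rw [h5, hs.input.origin i hi])
      (by rw [h6, hs.input.origin j hj]),
    hcur _ 0 6 5 l[j].1 l[i].1 (by simp) (by simp [hs.input.states])
      (by simp [h6, hs.input.origin j hj]) (by simp [h5, hs.input.origin i hi]),
    hcur _ 1 5 6 l[i].2.1 l[j].2.1 (by simp) (by simp [hs.input.states])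
      (by simp [h5, hs.input.target i hi]) (by simp [h6, hs.input.target j hj]),
    hcur _ 1 6 5 l[j].2.1 l[i].2.1 (by simp) (by simp [hs.input.states])
      (by simp [h6, hs.input.target j hj]) (by simp [h5, hs.input.target i hi]), hx', hy']
  set s₁ := (((s.setReg 8 (s.arr 9 x)).setReg 9 (negLit (s.arr 9 x))).setReg 10
    (s.arr 9 y)).setReg 11 (negLit (s.arr 9 y)) with hs₁def
  have hs₁ : Solving M l T D s₁ := (((hs.setReg (by omega) (by omega)).setReg (by omega)
    (by omega)).setReg (by omega) (by omega)).setReg (by omega) (by omega)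
  have harr : s₁.arr = s.arr := rfl
  have hpot : potential n s₁ = potential n s := rfl
  have r5 : s₁.reg 5 = i := by simp [hs₁def, h5]
  have r6 : s₁.reg 6 = j := by simp [hs₁def, h6]
  have r8 : s₁.reg 8 = s₁.arr 9 x := by simp [hs₁def]
  have r9 : s₁.reg 9 = negLit (s₁.arr 9 x) := by simp [hs₁def]
  have r10 : s₁.reg 10 = s₁.arr 9 y := by simp [hs₁def]
  have r11 : s₁.reg 11 = negLit (s₁.arr 9 y) := by simp [hs₁def]
  have e2 : (Expr.const 2).eval W s₁ = 2 := Expr.eval_const (by omega)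
  rw [← hpot]
  clear_value s₁
  have hcost : ∀ a p q, (Expr.current a p q).cost = 9 := fun a p q => by
    simp [Expr.current, Expr.entry, Expr.cost]
  simp only [hcost]
  -- a merge lowers the potential, which pays for its loop
  have hpay : ∀ p q t : ℕ, p < q → t ≤ (2 * n + 2) * 30 + 6 →
      t + p * (n * 60 + 66) ≤ q * (n * 60 + 66) := by
    intro p q t hpq ht
    have := Nat.mul_le_mul_right (n * 60 + 66) (Nat.succ_le_of_lt hpq)
    rw [Nat.succ_mul] at this
    omega
  refine Runs.cond_eq hW1 (fun hc => Runs.skip ?_) (fun hc => ?_)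
  · simp only [Expr.eval, r8, r10] at hc
    refine ⟨by simp [Expr.cost]; omega, r5, r6, hs₁.add_done fun _ => ⟨fun h => absurd h htgt,
      fun _ => hc⟩⟩
  simp only [Expr.eval, r8, r10] at hc
  refine Runs.cond_eq hW1 (fun hc' => Runs.assign ?_) (fun hc' => ?_)
  · simp only [Expr.eval, r8, r11] at hc'
    rw [Expr.eval_const hW1]
    have hno : ∀ ρ, ¬ IsModel M T ρ := by
      intro ρ hρ
      have h1 := (hs₁.complete ρ hρ).2
      have h2 := hxy ρ hρ
      rw [← h1 x hx, ← h1 y hy, hc', hρ.assignment.neg] at h2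
      exact iff_not_self h2.symm
    refine ⟨by simp [Expr.cost]; omega, by simp [r5], by simp [r6],
      (hs₁.fail hno).add_done fun h0 => ?_⟩
    simp at h0
  simp only [Expr.eval, r8, r11] at hc'
  refine Runs.cond_lt hW1 (fun hlt => ?_) (fun hlt => ?_)
  · rw [e2, Expr.eval, r8] at hlt
    -- the two literals are not both constants, as constants are equal or complementary
    have hge : 2 ≤ s₁.arr 9 y := by
      by_contra! hlt'
      unfold negLit at hc'
      split_ifs at hc' <;> omega
    refine (runs_substitute (by omega) hs₁.size (by omega) (by omega) (by omega)
      (by omega)).mono ?_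
    rintro s' t ⟨ht, hr, ha, h9⟩
    rw [r8, r9, r10, r11] at h9
    obtain ⟨h1, h2, h3⟩ := hs₁.merge hy hx hge hc hc' (fun ρ hρ => (hxy ρ hρ).symm) hr ha h9 hTlt
    have := hpay _ _ t h3 ht
    refine ⟨by simp [Expr.cost]; omega, by rw [hr 5 (by omega), r5], by rw [hr 6 (by omega), r6],
      h1.add_done fun _ => ⟨fun h => absurd h htgt, fun _ => h2.symm⟩⟩
  · rw [e2, Expr.eval, r8] at hlt
    refine (runs_substitute (by omega) hs₁.size (by omega) (by omega) (by omega)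
      (by omega)).mono ?_
    rintro s' t ⟨ht, hr, ha, h9⟩
    rw [r8, r9, r10, r11] at h9
    obtain ⟨h1, h2, h3⟩ := hs₁.merge hx hy (by omega) (Ne.symm hc)
      (fun h => hc' (eq_negLit_comm.2 h.symm)) hxy hr ha h9 hTlt
    have := hpay _ _ t h3 ht
    refine ⟨by simp [Expr.cost]; omega, by rw [hr 5 (by omega), r5], by rw [hr 6 (by omega), r6],
      h1.add_done fun _ => ⟨fun h => absurd h htgt, fun _ => h2⟩⟩

/-- Treat the pair of the edges number `r₅` and `r₆`. -/
def treatPair : Prog :=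
  .cond (.bin .eq (.get 1 (.reg 5)) (.get 1 (.reg 6)))
    (.cond (.bin .eq (.get 2 (.reg 5)) (.get 2 (.reg 6))) .skip (.assign 7 (.const 1)))
    (.cond (.bin .eq (.get 2 (.reg 5)) (.get 2 (.reg 6)))
      (.cond (.bin .eq (.get 0 (.reg 5)) (.get 0 (.reg 6))) .skip unify) .skip)

theorem runs_treatPair (hW : n * n + 2 * n + 10 < W) (hl : ∀ e ∈ l, e ∈ M.edges)
    (hTlt : ∀ u v, T u v < 2 * n + 2) (hTneg : ∀ u v, u ≠ v → T v u = negLit (T u v))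
    {i j : ℕ} (hi : i < l.length) (hj : j < l.length) (hs : Solving M l T D s)
    (h5 : s.reg 5 = i) (h6 : s.reg 6 = j) :
    Runs W treatPair (fun s' t => t + potential n s' * (n * 60 + 66) ≤
        potential n s * (n * 60 + 66) + 120 ∧ s'.reg 5 = i ∧ s'.reg 6 = j ∧
      Solving M l T (fun e f => D e f ∨ e = l[i] ∧ f = l[j]) s') s := by
  have hW1 : 1 < W := by omega
  have o5 : (Expr.get 0 (.reg 5)).eval W s = l[i].1 := by
    simp only [Expr.eval, h5, hs.input.origin i hi]
  have o6 : (Expr.get 0 (.reg 6)).eval W s = l[j].1 := by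
    simp only [Expr.eval, h6, hs.input.origin j hj]
  have t5 : (Expr.get 1 (.reg 5)).eval W s = l[i].2.1 := by
    simp only [Expr.eval, h5, hs.input.target i hi]
  have t6 : (Expr.get 1 (.reg 6)).eval W s = l[j].2.1 := by
    simp only [Expr.eval, h6, hs.input.target j hj]
  have a5 : (Expr.get 2 (.reg 5)).eval W s = l[i].2.2 := by
    simp only [Expr.eval, h5, hs.input.label i hi]
  have a6 : (Expr.get 2 (.reg 6)).eval W s = l[j].2.2 := by
    simp only [Expr.eval, h6, hs.input.label j hj]
  refine Runs.cond_eq hW1 (fun ht => Runs.cond_eq hW1 (fun ha => Runs.skip ?_)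
    (fun ha => Runs.assign ?_)) (fun ht => Runs.cond_eq hW1 (fun ha => Runs.cond_eq hW1
      (fun ho => Runs.skip ?_) (fun ho => ?_)) (fun ha => Runs.skip ?_)) <;>
    rw [t5, t6] at ht <;> rw [a5, a6] at ha
  · exact ⟨by simp [Expr.cost]; omega, h5, h6, hs.add_done fun _ =>
      ⟨fun _ => Fin.ext ha, fun h => absurd (Fin.ext ht) h.2.2⟩⟩
  · rw [Expr.eval_const hW1]
    have hno : ∀ ρ, ¬ IsModel M T ρ := fun ρ hρ => ha (congrArg Fin.val (hρ.consistent _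
      (hl _ (List.getElem_mem hi)) _ (hl _ (List.getElem_mem hj)) (Fin.ext ht)))
    refine ⟨by simp [Expr.cost]; omega, by simp [h5], by simp [h6],
      (hs.fail hno).add_done fun h0 => ?_⟩
    simp at h0
  · rw [o5, o6] at ho
    exact ⟨by simp [Expr.cost]; omega, h5, h6, hs.add_done fun _ =>
      ⟨fun h => absurd (congrArg Fin.val h) ht, fun h => absurd (Fin.ext ho) h.2.1⟩⟩
  · rw [o5, o6] at ho
    refine (runs_unify hW hl hTlt hTneg hi hj hs h5 h6 ⟨Fin.ext ha,
      fun h => ho (congrArg Fin.val h), fun h => ht (congrArg Fin.val h)⟩).mono ?_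
    rintro s' t ⟨h1, h2⟩
    exact ⟨by simp [Expr.cost]; omega, h2⟩
  · exact ⟨by simp [Expr.cost]; omega, h5, h6, hs.add_done fun _ =>
      ⟨fun h => absurd (congrArg Fin.val h) ht, fun h => absurd (congrArg Fin.val h.1) ha⟩⟩

/-- Start with the identical substitution and treat all pairs of edges. -/
def solve : Prog :=
  .seq (.assign 4 (.bin .add (.bin .add (.reg 0) (.reg 0)) (.const 2))) <|
  .seq (.forLt 5 4 (.store 9 (.reg 5) (.reg 5))) <|
  .seq (.assign 7 (.const 0)) <|
  .forLt 5 1 (.forLt 6 1 treatPair)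

theorem runs_solve (hW : n * n + 2 * n + l.length + 10 < W) (hl : ∀ e ∈ l, e ∈ M.edges)
    (hTlt : ∀ u v, T u v < 2 * n + 2) (hTneg : ∀ u v, u ≠ v → T v u = negLit (T u v))
    (hs : HoldsInput M l s) (hT : s.table = T) :
    Runs W solve (fun s' t =>
      t ≤ l.length * (l.length * 128 + 14) + (2 * n + 2) * (n * 60 + 80) + 30 ∧
      Solving M l T (fun e f => e ∈ l ∧ f ∈ l) s') s := by
  have hW1 : 1 < W := by omega
  have e0 : (Expr.bin .add (.bin .add (.reg 0) (.reg 0)) (.const 2)).eval W s = 2 * n + 2 := by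
    simp only [Expr.eval, Op.eval, hs.states]
    rw [Nat.mod_eq_of_lt (a := n + n) (by omega), Nat.mod_eq_of_lt (a := 2) (by omega),
      Nat.mod_eq_of_lt (by omega)]
    omega
  refine Runs.seq (Runs.assign (Runs.seq ?_))
  rw [e0]
  refine Runs.forLt_le (N := 2 * n + 2) (by omega) hW1 3
    (fun i s => HoldsInput M l s ∧ s.table = T ∧ s.reg 4 = 2 * n + 2 ∧ ∀ x < i, s.arr 9 x = x)
    ?_ ?_ ?_ ?_
  · rintro i s ⟨-, -, h, -⟩
    exact h
  · exact ⟨hs.congr (fun y hy => by simp [show y ≠ 4 by omega, show y ≠ 5 by omega]) (by simp),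
      hT, by simp, by simp⟩
  · rintro i hi s ⟨hs, hT, h4, h9⟩ h5
    refine Runs.store ?_
    simp only [Expr.eval, h5]
    refine ⟨by simp [Expr.cost], h5, by simpa using hs, ?_, by simpa using h4, ?_⟩
    · rw [← hT]
      funext u v
      simp [State.table]
    · intro x hx
      by_cases hxi : x = i
      · simp [hxi]
      · simpa [hxi] using h9 x (by omega)
  rintro s t₀ ht₀ ⟨hs, hT, h4, h9⟩
  refine Runs.seq (Runs.assign ?_)
  have ec : (Expr.const 0).eval W s = 0 := Expr.eval_const (by omega)
  rw [ec]
  have hsolve : Solving M l T (fun _ _ => False) (s.setReg 7 0) := by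
    refine ⟨by simpa using hs, by simpa using h4, hT, isSubst_id h9, by simp, ?_⟩
    intro ρ hρ
    refine ⟨by simp, fun c hc => ?_⟩
    rw [State.setReg_arr, h9 c hc]
  have hpot := potential_le n (s.setReg 7 0)
  generalize s.setReg 7 0 = s at hsolve hpot ⊢
  have hpot' := Nat.mul_le_mul_right (n * 60 + 66) hpot
  refine Runs.forLt (N := l.length) (by omega) hW1
    (fun i s t => t + potential n s * (n * 60 + 66) ≤
        (2 * n + 2) * (n * 60 + 66) + i * (l.length * 128 + 14) + 2 ∧
      Solving M l T (fun e f => e ∈ l.take i ∧ f ∈ l) s) ?_ ?_ ?_ ?_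
  · rintro i s t ⟨-, h⟩
    exact h.input.edges
  · exact ⟨by simp; omega, (hsolve.setReg (by omega) (by omega)).congr_done (by simp)⟩
  · rintro i hi s t ⟨ht, hs⟩ h5
    refine Runs.forLt (N := l.length) (by omega) hW1
      (fun j s' t' => t' + potential n s' * (n * 60 + 66) ≤
          potential n s * (n * 60 + 66) + j * 128 + 2 ∧ s'.reg 5 = i ∧
        Solving M l T (fun e f => (e ∈ l.take i ∧ f ∈ l) ∨ e = l[i] ∧ f ∈ l.take j) s')
      ?_ ?_ ?_ ?_
    · rintro i s t ⟨-, -, h⟩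
      exact h.input.edges
    · exact ⟨by simp; omega, by simpa using h5,
        (hs.setReg (by omega) (by omega)).congr_done (by simp)⟩
    · rintro j hj s' t' ⟨ht', h5', hs'⟩ h6
      refine (runs_treatPair (by omega) hl hTlt hTneg hi hj hs' h5' h6).mono ?_
      rintro s'' t'' ⟨h1, h2, h3, h4⟩
      refine ⟨h3, by simp; omega, by simpa using h2,
        (h4.setReg (by omega) (by omega)).congr_done ?_⟩
      rintro e f (h | ⟨rfl, h⟩)
      · exact Or.inl (Or.inl h)
      · rw [List.take_succ_eq_append_getElem hj, List.mem_append, List.mem_singleton] at h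
        rcases h with h | h
        · exact Or.inl (Or.inr ⟨rfl, h⟩)
        · exact Or.inr ⟨rfl, h⟩
    · rintro s' t' ⟨ht', h5', hs'⟩
      refine ⟨h5', ?_, (hs'.setReg (by omega) (by omega)).congr_done ?_⟩
      · have := add_one_mul i (l.length * 128 + 14)
        simp only [potential_setReg]
        omega
      · rintro e f ⟨he, hf⟩
        rw [List.take_succ_eq_append_getElem hi, List.mem_append, List.mem_singleton] at he
        rcases he with h | h
        · exact Or.inl ⟨h, hf⟩
        · exact Or.inr ⟨h, by simpa using hf⟩
  · rintro s' t' ⟨ht', hs'⟩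
    refine ⟨?_, hs'.congr_done (by simp)⟩
    have h1 : (2 * n + 2) * (n * 60 + 80) = (2 * n + 2) * (n * 60 + 66) + (2 * n + 2) * 14 := by
      ring
    simp only [Expr.cost]
    omega

end WordRAM

namespace WordRAM

variable {n k W : ℕ} {M : DNFA 2 (Fin n) (Fin k)} {l : List (Fin n × Fin n × Fin k)}
  {s : State} {T : Fin n → Fin n → ℕ}

/-! ### Listing the states -/

/-- Unless a contradiction was found, store every state `r₅` in the cell of array 0 whose number
`r₈` is the number of preceding states. -/
def output : Prog :=
  .cond (.reg 7) (.assign 0 (.const 0)) <|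
  .seq (.forLt 5 0 <| .seq (.assign 8 (.const 0)) <|
    .seq (.forLt 6 0 (.assign 8 (.bin .add (.reg 8)
      (.bin .mod (.get 9 (.get 8 (.entry (.reg 6) (.reg 5)))) (.const 2)))))
    (.store 0 (.reg 8) (.reg 5)))
  (.assign 0 (.const 1))

/-- The number of states which precede `v` according to the substitution `σ`. -/
def rank (σ : ℕ → ℕ) (T : Fin n → Fin n → ℕ) (v : Fin n) : ℕ :=
  (Finset.univ.filter fun u => σ (T u v) % 2 = 1).card

theorem runs_output (hW : n * n + 2 * n + 10 < W) (h0 : s.reg 0 = n) (hT : s.table = T)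
    (h7 : s.reg 7 = 0) (hrank : Function.Injective (rank (s.arr 9) T)) :
    Runs W output (fun s' t => t ≤ n * (n * 30 + 30) + 30 ∧ s'.reg 0 = 1 ∧
      ∀ v : Fin n, s'.arr 0 (rank (s.arr 9) T v) = v) s := by
  have hW1 : 1 < W := by omega
  refine Runs.cond (fun h => absurd h7 h) (fun _ => Runs.seq ?_)
  refine Runs.forLt_le (N := n) (by omega) hW1 (n * 30 + 22)
    (fun i s' => s'.reg 0 = n ∧ s'.arr 8 = s.arr 8 ∧ s'.arr 9 = s.arr 9 ∧
      ∀ v : Fin n, v < i → s'.arr 0 (rank (s.arr 9) T v) = v) ?_ ?_ ?_ ?_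
  · rintro i s' ⟨h, -⟩
    exact h
  · exact ⟨by simp [h0], rfl, rfl, by simp⟩
  · rintro i hi s₁ ⟨h0, h8, h9, hv⟩ h5
    lift i to Fin n using hi with v
    refine Runs.seq (Runs.assign (Runs.seq ?_))
    rw [Expr.eval_const (by omega)]
    refine Runs.forLt_le (N := n) (by omega) hW1 20
      (fun j s' => s'.reg 0 = n ∧ s'.reg 5 = v ∧ s'.arr = s₁.arr ∧
        s'.reg 8 = ∑ u ∈ Finset.range j, s₁.arr 9 (s₁.arr 8 (u * n + v)) % 2 ∧ s'.reg 8 ≤ j)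
        ?_ ?_ ?_ ?_
    · rintro i s' ⟨h, -⟩
      exact h
    · exact ⟨by simp [h0], by simp [h5], rfl, by simp, by simp⟩
    · rintro j hj s' ⟨h0, h5, harr, hr8, hle⟩ h6
      refine Runs.assign ?_
      have he : (Expr.entry (.reg 6) (.reg 5)).eval W s' = j * n + v :=
        Expr.eval_entry (u := ⟨j, hj⟩) (v := v) (by omega) h0 h6 h5
      have hlt : s₁.arr 9 (s₁.arr 8 (j * n + v)) % 2 < 2 := Nat.mod_lt _ (by omega)
      have hev : (Expr.bin .add (.reg 8) (.bin .mod (.get 9 (.get 8 (.entry (.reg 6) (.reg 5))))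
          (.const 2))).eval W s' = s'.reg 8 + s₁.arr 9 (s₁.arr 8 (j * n + v)) % 2 := by
        simp only [Expr.eval, Op.eval, he, harr]
        rw [Nat.mod_eq_of_lt (a := 2) (by omega), Nat.mod_eq_of_lt (b := W) (a := _ % 2) (by omega),
          Nat.mod_eq_of_lt (by omega)]
      rw [hev]
      refine ⟨by simp [Expr.cost, Expr.entry], by simp [h6], by simp [h0], by simp [h5], harr,
        ?_, ?_⟩
      · simp [Finset.sum_range_succ, hr8]
      · simp
        omega
    · rintro s' t ht ⟨h0, h5, harr, hr8, hle⟩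
      refine Runs.store ?_
      have hr : s'.reg 8 = rank (s.arr 9) T v := by
        rw [hr8, ← Fin.sum_univ_eq_sum_range (fun u => s₁.arr 9 (s₁.arr 8 (u * n + v)) % 2), h8, h9]
        simp only [rank, Finset.card_filter, ← hT, State.table]
        refine Finset.sum_congr rfl fun u _ => ?_
        split_ifs <;> omega
      simp only [Expr.eval, hr, h5]
      refine ⟨by simp [Expr.cost]; omega, h5, by simp [h0], by simp [harr, h8],
        by simp [harr, h9], ?_⟩
      intro u hu
      by_cases huv : u = v
      · simp [huv]
      · have hne : rank (s.arr 9) T u ≠ rank (s.arr 9) T v := fun h => huv (hrank h)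
        have hlt : (u : ℕ) < v := by
          have : (u : ℕ) ≠ v := fun h => huv (Fin.ext h)
          omega
        simp [hne, harr, hv u hlt]
  · rintro s' t ht ⟨h0, h8, h9, hv⟩
    refine Runs.assign ?_
    rw [Expr.eval_const hW1]
    have h1 : n * (n * 30 + 30) = n * (n * 30 + 22 + 8) := rfl
    exact ⟨by simp [Expr.cost]; omega, by simp, fun v => hv v v.2⟩

theorem runs_output_of_ne (h7 : s.reg 7 ≠ 0) :
    Runs W output (fun s' t => t ≤ 30 ∧ s'.reg 0 = 0) s :=
  Runs.cond (fun _ => Runs.assign ⟨by simp [Expr.cost], by simp [Expr.eval]⟩)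
    (fun h => absurd h h7)

/-- Counting predecessors turns a strict total order into a permutation. -/
theorem exists_perm_of_order {lt : Fin n → Fin n → Prop} [DecidableRel lt]
    (h : IsStrictTotalOrder (Fin n) lt) :
    ∃ π : Equiv.Perm (Fin n), (∀ v, (π.symm v : ℕ) = (Finset.univ.filter fun u => lt u v).card) ∧
      ∀ u v, π.symm u < π.symm v ↔ lt u v := by
  let c : Fin n → ℕ := fun v => (Finset.univ.filter fun w => lt w v).card
  have hmono : ∀ u v, lt u v → c u < c v := by
    intro u v huv
    refine Finset.card_lt_card ((Finset.ssubset_iff_of_subset ?_).2 ⟨u, ?_, ?_⟩)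
    · intro w hw
      simp only [Finset.mem_filter_univ] at hw ⊢
      exact h.trans _ _ _ hw huv
    · simpa using huv
    · simpa using h.irrefl u
  have hiff : ∀ u v, c u < c v ↔ lt u v := by
    refine fun u v => ⟨fun hlt => ?_, hmono u v⟩
    by_contra hn
    by_cases hvu : lt v u
    · exact absurd hlt (hmono v u hvu).le.not_gt
    · rw [h.trichotomous u v hn hvu] at hlt
      exact lt_irrefl _ hlt
  have hbound : ∀ v, c v < n := by
    intro v
    have := Finset.card_lt_card (s := (Finset.univ.filter fun w => lt w v)) (t := Finset.univ)
      ((Finset.ssubset_iff_of_subset (Finset.subset_univ _)).2 ⟨v, Finset.mem_univ _, by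
        simpa using h.irrefl v⟩)
    simpa using this
  let r : Fin n → Fin n := fun v => ⟨_, hbound v⟩
  have hinj : Function.Injective r := by
    intro u v huv
    have e : c u = c v := congrArg Fin.val huv
    refine h.trichotomous u v (fun h1 => ?_) (fun h1 => ?_)
    · exact absurd (hmono _ _ h1) (by omega)
    · exact absurd (hmono _ _ h1) (by omega)
  exact ⟨(Equiv.ofBijective r (Finite.injective_iff_bijective.1 hinj)).symm,
    fun v => rfl, fun u v => hiff u v⟩

end WordRAM

/-! ### The decision procedure -/

theorem DNFA.card_states_le {d n k : ℕ} (M : DNFA d (Fin n) (Fin k)) :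
    n ≤ M.edges.card + 1 := by
  have hsub : Finset.univ.erase M.start ⊆ M.edges.image fun e => e.2.1 := by
    intro v hv
    have h := (not_congr (M.no_in_edge_iff v)).2 (Finset.ne_of_mem_erase hv)
    rw [not_not] at h
    obtain ⟨u, a, h⟩ := h
    exact Finset.mem_image.2 ⟨_, h, rfl⟩
  have h1 := (Finset.card_le_card hsub).trans Finset.card_image_le
  rw [Finset.card_erase_of_mem (Finset.mem_univ _), Finset.card_univ, Fintype.card_fin] at h1
  omega

namespace WordRAM

/-- Decide whether an automaton is a Wheeler graph, with the answer in register 0, and if it is,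
list its states in a Wheeler order in array 0. -/
def wheelerSort : Prog := .seq search (.seq tabulate (.seq solve output))

theorem runs_wheelerSort {n k W : ℕ} (M : DNFA 2 (Fin n) (Fin k))
    (l : List (Fin n × Fin n × Fin k)) (hW : n * n + 2 * n + l.length + 10 < W)
    (hl : ∀ e, e ∈ l ↔ e ∈ M.edges) :
    Runs W wheelerSort (fun s t =>
      t ≤ n * (l.length * 60 + 20) + n * (n * 80 + 20) + l.length * (l.length * 128 + 14) +
        (2 * n + 2) * (n * 60 + 80) + n * (n * 30 + 30) + 100 ∧
      (IsWheelerGraph M.edges → s.reg 0 = 1) ∧ (¬ IsWheelerGraph M.edges → s.reg 0 = 0) ∧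
      (IsWheelerGraph M.edges → ∃ π : Equiv.Perm (Fin n), (∀ i : Fin n, s.arr 0 i = π i) ∧
        IsWheelerOrder M.edges (fun u v => π.symm u < π.symm v))) (M.input l) := by
  have hsearch := runs_search (W := W) (by omega) hl (holdsInput_input M l)
    (by intro v; simp [DNFA.input])
  refine Runs.seq (hsearch.mono ?_)
  rintro s₁ t₁ ⟨ht₁, par, lb, pos, htree, hs₁⟩
  refine Runs.seq ((runs_tabulate (by omega) htree hs₁).mono ?_)
  rintro s₂ t₂ ⟨ht₂, hs₂, hT⟩
  refine Runs.seq ((runs_solve (T := s₂.table) hW (fun e => (hl e).1) (htree.pairLit_lt hT)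
    (htree.pairLit_swap hT) hs₂ rfl).mono ?_)
  rintro s₃ t₃ ⟨ht₃, hs₃⟩
  by_cases h7 : s₃.reg 7 = 0
  · have hsat : ∀ e ∈ M.edges, ∀ f ∈ M.edges, Satisfies s₂.table (s₃.arr 9) e f :=
      fun e he f hf => hs₃.sound h7 e f ⟨(hl e).2 he, (hl f).2 hf⟩
    have hord := htree.isWheelerOrder_of_subst (fun e he f hf => (hsat e he f hf).1) hT hs₃.subst
      (fun e he f hf => (hsat e he f hf).2)
    obtain ⟨π, hπ, hlt⟩ := exists_perm_of_order hord.total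
    have hrank : ∀ v, rank (s₃.arr 9) s₂.table v = π.symm v := fun v => (hπ v).symm
    have hinj : Function.Injective (rank (n := n) (s₃.arr 9) s₂.table) := by
      intro u v huv
      rw [hrank, hrank] at huv
      exact π.symm.injective (Fin.ext huv)
    refine (runs_output (by omega) hs₃.input.states hs₃.table h7 hinj).mono ?_
    rintro s₄ t₄ ⟨ht₄, h0, hlist⟩
    refine ⟨by omega, fun _ => h0, fun h => absurd ⟨_, hord⟩ h, fun _ => ⟨π, ?_, ?_⟩⟩
    · intro i
      have := hlist (π i)
      rwa [hrank, Equiv.symm_apply_apply] at this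
    · simpa only [hlt] using hord
  · have hno : ¬ IsWheelerGraph M.edges := by
      rintro ⟨lt, hlt⟩
      obtain ⟨ρ, hρ, hρT⟩ := htree.exists_assignment hT hlt
      refine h7 (hs₃.complete ρ ⟨hρ, hlt.isInputConsistent, fun e he f hf hef => ?_⟩).1
      rw [hρT _ _ hef.2.1, hρT _ _ hef.2.2]
      exact hlt.linked_iff he hf hef
    refine (runs_output_of_ne h7).mono ?_
    rintro s₄ t₄ ⟨ht₄, h0⟩
    exact ⟨by omega, fun h => absurd h hno, fun _ => h0, fun h => absurd h hno⟩

end WordRAM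

theorem word_bound {n m : ℕ} (h : n ≤ m + 1) : n * n + 2 * n + m + 10 < (m + 2) ^ 4 :=
  calc n * n + 2 * n + m + 10 ≤ (m + 1) * (m + 1) + 2 * (m + 1) + m + 10 := by gcongr
    _ < (m ^ 4 + 8 * m ^ 3 + 23 * m ^ 2 + 27 * m + 3) +
        ((m + 1) * (m + 1) + 2 * (m + 1) + m + 10) := Nat.lt_add_of_pos_left (by omega)
    _ = (m + 2) ^ 4 := by ring

theorem time_bound {n m C : ℕ} (h : n ≤ m + 1) (hC : 2000 ≤ C) :
    n * (m * 60 + 20) + n * (n * 80 + 20) + m * (m * 128 + 14) + (2 * n + 2) * (n * 60 + 80) +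
      n * (n * 30 + 30) + 100 ≤ C * (m ^ 2 + 1) := by
  have hm : m ≤ m ^ 2 := Nat.le_self_pow (by omega) m
  calc _ ≤ (m + 1) * (m * 60 + 20) + (m + 1) * ((m + 1) * 80 + 20) + m * (m * 128 + 14) +
        (2 * (m + 1) + 2) * ((m + 1) * 60 + 80) + (m + 1) * ((m + 1) * 30 + 30) + 100 := by gcongr
    _ = 418 * m ^ 2 + 884 * m + 840 := by ring
    _ ≤ 2000 * (m ^ 2 + 1) := by omega
    _ ≤ C * (m ^ 2 + 1) := by gcongr

/-- One fixed word RAM program decides, in time `O(|E|²)`, whether a given 2-NFA is a Wheeler graph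
(answer in register 0) and, if it is, lists the states in a Wheeler order (in array 0).  The edges
may be listed in the input in any order, and words of `O(log (|E| + |Σ|))` bits suffice. -/
theorem mainTheorem4 :
    ∃ (p : WordRAM.Prog) (C : ℕ),
      ∀ (n k : ℕ) (M : DNFA 2 (Fin n) (Fin k)) (l : List (Fin n × Fin n × Fin k)) (W : ℕ),
        l.Nodup → l.toFinset = M.edges → (M.edges.card + k + 2) ^ C ≤ W →
        ∃ (s : WordRAM.State) (t : ℕ),
          WordRAM.Exec W p (M.input l) s t ∧
          t ≤ C * (M.edges.card ^ 2 + 1) ∧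
          (IsWheelerGraph M.edges → s.reg 0 = 1) ∧
          (¬ IsWheelerGraph M.edges → s.reg 0 = 0) ∧
          (IsWheelerGraph M.edges →
            ∃ π : Equiv.Perm (Fin n),
              (∀ i : Fin n, s.arr 0 i = π i) ∧
              IsWheelerOrder M.edges (fun u v => π.symm u < π.symm v)) := by
  -- `2000` satisfies the time bound; as an explicit exponent it would be costly to elaborate
  obtain ⟨C, hC⟩ : ∃ C, 2000 ≤ C := ⟨2000, le_rfl⟩
  refine ⟨WordRAM.wheelerSort, C, fun n k M l W hnd hl hW => ?_⟩
  have hlen : l.length = M.edges.card := by rw [← hl, List.toFinset_card_of_nodup hnd]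
  have hn := M.card_states_le
  have hpow : (M.edges.card + 2) ^ 4 ≤ W :=
    calc (M.edges.card + 2) ^ 4 ≤ (M.edges.card + k + 2) ^ 4 :=
          Nat.pow_le_pow_left (by omega) 4
      _ ≤ (M.edges.card + k + 2) ^ C := Nat.pow_le_pow_right (by omega) (by omega)
      _ ≤ W := hW
  clear hW
  have hW' : n * n + 2 * n + l.length + 10 < W := by
    rw [hlen]
    exact (word_bound hn).trans_le hpow
  obtain ⟨s, t, he, ht, h⟩ := WordRAM.runs_wheelerSort M l hW' fun e => by
    rw [← hl, List.mem_toFinset]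
  rw [hlen] at ht
  exact ⟨s, t, he, ht.trans (time_bound hn hC), h⟩
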